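/- Let $W$ be a standard one-dimensional Brownian motion on a probability space, $(\mathcal F_r)$ its augmented natural filtration, $T>0$ and $c^+\ge 0$. Consider the liquidation problem with stock price $dX_r=X_r\,dW_r$, running payoff $f(\pi,x)=\pi x$, terminal payoff $g=0$ and selling rates in $[0,c^+]$. For $t\in[0,T)$, $q>0$ and a rate $\pi$ put $$Q^\pi_r=q-\int_t^r\pi_s\,ds,\qquad \tau^\pi=T\wedge\min\{r\ge t: Q^\pi_r=0\},$$ with the convention that $\pi_r=0$ and $Q^\pi_r=0$ for $r>\tau^\pi$. Let $c$ be the (optimal) control started at time $t$ from inventory $q$, $$c_r=\frac{q}{T-t}\ \text{ if } q\le c^+(T-t),\qquad c_r=c^+\ \text{ if } q>c^+(T-t)\qquad(r\in[t,T]),$$ and let $Q,\tau$ be its inventory and liquidation time. For $\bar c\in[0,c^+]$ and small $\theta>0$ put $\gamma=\int_t^{(t+\theta)\wedge\tau}(\bar c-c_s)\,ds$ and $$c^{\theta}_r=c_r1_{r\in[0,t)}+\bar c\,1_{r\in[t,(t+\theta)\wedge\tau)}+c_r1_{r\in[t+\theta,\tau)}-\frac{\gamma}{\theta}1_{r\ge\tau},$$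 with inventory $Q^\theta$ and liquidation time $\tau^\theta$, and let $\hat c^\theta=\max(c,c^\theta)$. With $\mathbb E^t$ the expectation for the problem started from $X_t=x$, $Q_t=q$, put $$\bar f(t,\bar c,x,q)=\lim_{\theta\downarrow0}\mathbb E^t\Big[\frac{\operatorname{sign}(\tau-\tau^\theta)}{\theta}\int_{\tau\wedge\tau^\theta}^{\tau\vee\tau^\theta}f(\hat c^\theta_r,X_r)\,dr\Big],\qquad \bar g(t,\bar c,x,q)=\lim_{\theta\downarrow0}\mathbb E^t\Big[\frac{g(X_\tau,Q^\theta_{\tau^\theta})-g(X_{\tau^\theta},Q^\theta_{\tau^\theta})}{\theta}\Big],$$ $$\mathcal G(t,\bar c,x,q)=(\bar c-c_t)\,\mathbb E^t[\partial_qg(X_\tau,Q_\tau)1_{\Lambda}]-\bar g(t,\bar c,x,q)-\bar f(t,\bar c,x,q),$$ where $\Lambda=(\{Q_T=0\}\cap\{\bar c\ge c_t\})\cup(\{\tau<T\}\cap\{\bar c<c_t\})$. (i) For all $t\in[0,T)$, $\bar c\in[0,c^+]$, $x>0$ and $q>0$ the limit $\bar f$ exists and $$\bar f(t,\bar c,x,q)=\begin{cases}(\bar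 c-c_t)\,x\,1_{\bar c\ge c_t}&\text{if } q\le c^+(T-t),\\ 0&\text{if } q>c^+(T-t).\end{cases}$$ (ii) The limit $\bar g$ also exists, so that $\mathcal G$ is well defined, and the Hamiltonian condition holds: let $t_0\in[0,T)$, $x_0>0$, $q_0>0$, let $X$ be the price with $X_{t_0}=x_0$, let $c$ be the control above started at $t_0$ from $q_0$, with $Q$ and $\tau$, and let $(Y,Z)$ be any solution on $[t_0,\tau]$ of the BSDE $-dY_r=\partial_qf(c_r,X_r)\,dr-Z_r\,dW_r$, $Y_\tau=\partial_qg(X_\tau,Q_\tau)$. Then, with $\mathcal H(\pi,x,y)=-\pi y+f(\pi,x)$, for every $t\in[t_0,\tau)$ and every $\bar c\in[0,c^+]$, $$\mathcal H(\bar c,X_t,Y_t)-\mathcal H(c_t,X_t,Y_t)+\mathcal G(t,\bar c,X_t,Q_t)\le0\quad\text{a.s.}$$ Here stochastic integrals, in the price equation and in the BSDE, are Itô integrals of square-integrable adapted integrands. -/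

import Mathlib

open MeasureTheory ProbabilityTheory Filter Set
open scoped Topology NNReal ENNReal

noncomputable section

namespace Liquidation

/-! ### Brownian filtration and the Itô integral -/

section Stochastic

/-- The natural filtration of `W`, augmented by the `P`-null events. Times are real numbers; only
times `r ≥ 0` matter, and `W` at time `r` is `W r.toNNReal`. -/
def brownianFiltration {Ω : Type*} {mΩ : MeasurableSpace Ω} (P : Measure Ω) (W : ℝ≥0 → Ω → ℝ)
    (hW : ∀ s, Measurable (W s)) : Filtration ℝ mΩ where
  seq r := (⨆ s : ℝ≥0, ⨆ _ : s ≤ r.toNNReal, MeasurableSpace.comap (W s) inferInstance) ⊔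
    MeasurableSpace.generateFrom {N | MeasurableSet N ∧ P N = 0}
  mono' r r' h := by
    refine sup_le_sup_right (iSup_mono fun s => ?_) _
    exact iSup_le fun hs => le_iSup_of_le (hs.trans (Real.toNNReal_mono h)) le_rfl
  le' r := by
    refine sup_le (iSup_le fun s => iSup_le fun _ => (hW s).comap_le) ?_
    exact MeasurableSpace.generateFrom_le fun N hN => hN.1

/-- A simple (elementary) adapted process on `[a, b]`: a finite sum of terms
`ξ i * 1_{(left i, right i]}`, where `ξ i` is bounded and measurable at time `left i`. -/
structure SimpleProcess {Ω : Type*} {mΩ : MeasurableSpace Ω} (𝓕 : Filtration ℝ mΩ)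
    (a b : ℝ) where
  n : ℕ
  left : Fin n → ℝ
  right : Fin n → ℝ
  coef : Fin n → Ω → ℝ
  le_left : ∀ i, a ≤ left i
  left_le_right : ∀ i, left i ≤ right i
  right_le : ∀ i, right i ≤ b
  measurable_coef : ∀ i, Measurable[𝓕 (left i)] (coef i)
  bounded_coef : ∀ i, ∃ C : ℝ, ∀ ω, |coef i ω| ≤ C

/-- The value of a simple process at time `r`. -/
def SimpleProcess.value {Ω : Type*} {mΩ : MeasurableSpace Ω} {𝓕 : Filtration ℝ mΩ} {a b : ℝ}
    (V : SimpleProcess 𝓕 a b) (r : ℝ) (ω : Ω) : ℝ :=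
  ∑ i, (Ioc (V.left i) (V.right i)).indicator (fun _ => V.coef i ω) r

/-- The stochastic integral `∫_a^b V_r dW_r` of a simple process. -/
def SimpleProcess.integral {Ω : Type*} {mΩ : MeasurableSpace Ω} {𝓕 : Filtration ℝ mΩ} {a b : ℝ}
    (V : SimpleProcess 𝓕 a b) (W : ℝ≥0 → Ω → ℝ) (ω : Ω) : ℝ :=
  ∑ i, V.coef i ω * (W (V.right i).toNNReal ω - W (V.left i).toNNReal ω)

/-- `I` is (a version of) the Itô integral `∫_a^b H_r dW_r`: `H` is in `L²(dr ⊗ P)` on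
`[a, b] × Ω`, and there are simple adapted processes that converge to `H` in `L²(dr ⊗ P)` and
whose stochastic integrals converge to `I` in `L²(P)`. -/
def IsItoIntegral {Ω : Type*} {mΩ : MeasurableSpace Ω} (P : Measure Ω) (W : ℝ≥0 → Ω → ℝ)
    (hW : ∀ s, Measurable (W s)) (a b : ℝ) (H : ℝ → Ω → ℝ) (I : Ω → ℝ) : Prop :=
  MemLp (fun p : ℝ × Ω => H p.1 p.2) 2 ((volume.restrict (Icc a b)).prod P) ∧
  MemLp I 2 P ∧
  ∃ V : ℕ → SimpleProcess (brownianFiltration P W hW) a b,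
    Tendsto (fun n => eLpNorm (fun p : ℝ × Ω => H p.1 p.2 - (V n).value p.1 p.2) 2
      ((volume.restrict (Icc a b)).prod P)) atTop (𝓝 0) ∧
    Tendsto (fun n => eLpNorm (fun ω => I ω - (V n).integral W ω) 2 P) atTop (𝓝 0)

/-- `X` is a (strong) solution on `[t, T]` of `dX_r = μ(r, X_r) dr + σ(r, X_r) dW_r`, `X_t = x`:
it is adapted to the Brownian filtration, has continuous paths almost surely, and satisfies the
integral equation, with the stochastic integral in the sense of Itô. -/
structure IsSDESolution {Ω : Type*} {mΩ : MeasurableSpace Ω} (P : Measure Ω) (W : ℝ≥0 → Ω → ℝ)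
    (hW : ∀ s, Measurable (W s)) (μ σ : ℝ → ℝ → ℝ) (t T x : ℝ) (X : ℝ → Ω → ℝ) : Prop where
  adapted : ∀ r ∈ Icc t T, Measurable[brownianFiltration P W hW r] (X r)
  continuous : ∀ᵐ ω ∂P, ContinuousOn (fun r => X r ω) (Icc t T)
  initial : ∀ᵐ ω ∂P, X t ω = x
  drift_integrable : ∀ᵐ ω ∂P, IntervalIntegrable (fun s => μ s (X s ω)) volume t T
  equation : ∀ r ∈ Icc t T, IsItoIntegral P W hW t r (fun s ω => σ s (X s ω))
    (fun ω => X r ω - x - ∫ s in t..r, μ s (X s ω))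

end Stochastic

/-! ### Inventory, liquidation time and the variation of a control

A control is given on `[t, T]` by its rate `c : ℝ → ℝ`, with inventory `q` at time `t`. -/

/-- The inventory `q - ∫_t^r c_s ds`, before the convention that it vanishes after liquidation. -/
def rawInventory (t q : ℝ) (c : ℝ → ℝ) (r : ℝ) : ℝ := q - ∫ s in t..r, c s

/-- `T ∧ min {r ≥ t | Q_r = 0}`. -/
def liqTime (T t q : ℝ) (c : ℝ → ℝ) : ℝ :=
  sInf (insert T {r | t ≤ r ∧ rawInventory t q c r = 0})

/-- The inventory, set to `0` after the liquidation time. -/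
def inventory (T t q : ℝ) (c : ℝ → ℝ) (r : ℝ) : ℝ :=
  if r ≤ liqTime T t q c then rawInventory t q c r else 0

/-- The control, set to `0` after the liquidation time. -/
def stoppedControl (T t q : ℝ) (c : ℝ → ℝ) (r : ℝ) : ℝ :=
  if r ≤ liqTime T t q c then c r else 0

/-- `γ_r = ∫_t^{r ∧ τ} (c̄ - c_s) ds`. -/
def gammaVar (T t q : ℝ) (c : ℝ → ℝ) (cbar r : ℝ) : ℝ :=
  ∫ s in t..(min r (liqTime T t q c)), (cbar - c s)

/-- The variation of `c` which uses the constant rate `c̄` on `[t, (t + θ) ∧ τ)`. -/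
def variation (T t q : ℝ) (c : ℝ → ℝ) (cbar θ : ℝ) (r : ℝ) : ℝ :=
  (Ico 0 t).indicator c r
    + (Ico t (min (t + θ) (liqTime T t q c))).indicator (fun _ => cbar) r
    + (Ico (t + θ) (liqTime T t q c)).indicator c r
    - (Ici (liqTime T t q c)).indicator (fun _ => gammaVar T t q c cbar (t + θ) / θ) r

/-- The liquidation time of the variation. -/
def liqTimeVar (T t q : ℝ) (c : ℝ → ℝ) (cbar θ : ℝ) : ℝ :=
  liqTime T t q (variation T t q c cbar θ)

/-- The maximum of the two controls (both with the convention above). -/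
def maxControl (T t q : ℝ) (c : ℝ → ℝ) (cbar θ r : ℝ) : ℝ :=
  max (stoppedControl T t q c r) (stoppedControl T t q (variation T t q c cbar θ) r)

/-- The maximum of the two inventories. -/
def maxInventory (T t q : ℝ) (c : ℝ → ℝ) (cbar θ r : ℝ) : ℝ :=
  max (inventory T t q c r) (inventory T t q (variation T t q c cbar θ) r)

/-! ### The terms of the Hamiltonian condition

`X` is the price process of the problem that starts at time `t`, from `X_t = x` and inventory
`Q_t = q`; so the expectation below is `𝔼[ · | X_t = x, Q_t = q]`. -/

section Terms

/-- The running payoff between the two liquidation times. -/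
def runningDiff {Ω : Type*} (f : ℝ → ℝ → ℝ → ℝ → ℝ) (T t q : ℝ) (c : ℝ → ℝ) (cbar : ℝ)
    (X : ℝ → Ω → ℝ) (θ : ℝ) (ω : Ω) : ℝ :=
  Real.sign (liqTime T t q c - liqTimeVar T t q c cbar θ) / θ *
    ∫ r in (min (liqTime T t q c) (liqTimeVar T t q c cbar θ))..
        (max (liqTime T t q c) (liqTimeVar T t q c cbar θ)),
      f r (maxControl T t q c cbar θ r) (X r ω) (maxInventory T t q c cbar θ r)

/-- The limit which defines `f̄` exists and equals `L`. For small `θ > 0` the integral over time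
and the expectation are required to be those of integrable functions. -/
def HasFbar {Ω : Type*} {mΩ : MeasurableSpace Ω} (P : Measure Ω) (f : ℝ → ℝ → ℝ → ℝ → ℝ)
    (T t q : ℝ) (c : ℝ → ℝ) (cbar : ℝ) (X : ℝ → Ω → ℝ) (L : ℝ) : Prop :=
  (∀ᶠ θ in 𝓝[>] (0 : ℝ),
    (∀ᵐ ω ∂P, IntervalIntegrable
      (fun r => f r (maxControl T t q c cbar θ r) (X r ω) (maxInventory T t q c cbar θ r)) volume
      (min (liqTime T t q c) (liqTimeVar T t q c cbar θ))
      (max (liqTime T t q c) (liqTimeVar T t q c cbar θ))) ∧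
    Integrable (runningDiff f T t q c cbar X θ) P) ∧
  Tendsto (fun θ => ∫ ω, runningDiff f T t q c cbar X θ ω ∂P) (𝓝[>] (0 : ℝ)) (𝓝 L)

/-- The difference quotient of the terminal payoff. -/
def terminalDiff {Ω : Type*} (g : ℝ → ℝ → ℝ) (T t q : ℝ) (c : ℝ → ℝ) (cbar : ℝ)
    (X : ℝ → Ω → ℝ) (θ : ℝ) (ω : Ω) : ℝ :=
  (g (X (liqTime T t q c) ω)
      (inventory T t q (variation T t q c cbar θ) (liqTimeVar T t q c cbar θ))
    - g (X (liqTimeVar T t q c cbar θ) ω)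
      (inventory T t q (variation T t q c cbar θ) (liqTimeVar T t q c cbar θ))) / θ

/-- The limit which defines `ḡ` exists and equals `L`. -/
def HasGbar {Ω : Type*} {mΩ : MeasurableSpace Ω} (P : Measure Ω) (g : ℝ → ℝ → ℝ)
    (T t q : ℝ) (c : ℝ → ℝ) (cbar : ℝ) (X : ℝ → Ω → ℝ) (L : ℝ) : Prop :=
  (∀ᶠ θ in 𝓝[>] (0 : ℝ), Integrable (terminalDiff g T t q c cbar X θ) P) ∧
  Tendsto (fun θ => ∫ ω, terminalDiff g T t q c cbar X θ ω ∂P) (𝓝[>] (0 : ℝ)) (𝓝 L)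

/-- The event `Λ(t, c̄) = ({Q_T = 0} ∩ {c̄ ≥ c_t}) ∪ ({τ < T} ∩ {c̄ < c_t})`, as a proposition. -/
def LambdaEvent (T t q : ℝ) (c : ℝ → ℝ) (cbar : ℝ) : Prop :=
  (inventory T t q c T = 0 ∧ c t ≤ cbar) ∨ (liqTime T t q c < T ∧ cbar < c t)

open Classical in
/-- The random variable `∂_q g(X_τ, Q_τ) 1_Λ`. -/
def terminalMarginal {Ω : Type*} (g : ℝ → ℝ → ℝ) (T t q : ℝ) (c : ℝ → ℝ) (cbar : ℝ)
    (X : ℝ → Ω → ℝ) (ω : Ω) : ℝ :=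
  if LambdaEvent T t q c cbar then
    deriv (fun q' => g (X (liqTime T t q c) ω) q') (inventory T t q c (liqTime T t q c))
  else 0

/-- `G` is the value of `𝒢(t, c̄, x, q) = (c̄ - c_t) 𝔼ᵗ[∂_q g(X_τ, Q_τ) 1_Λ] - ḡ - f̄`. -/
def HasSupplementaryTerm {Ω : Type*} {mΩ : MeasurableSpace Ω} (P : Measure Ω)
    (f : ℝ → ℝ → ℝ → ℝ → ℝ) (g : ℝ → ℝ → ℝ) (T t q : ℝ) (c : ℝ → ℝ) (cbar : ℝ)
    (X : ℝ → Ω → ℝ) (G : ℝ) : Prop :=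
  ∃ gbar fbar : ℝ, HasGbar P g T t q c cbar X gbar ∧ HasFbar P f T t q c cbar X fbar ∧
    Integrable (terminalMarginal g T t q c cbar X) P ∧
    G = (cbar - c t) * (∫ ω, terminalMarginal g T t q c cbar X ω ∂P) - gbar - fbar

/-- `(Y, Z)` solves, on `[t, τ]`, the BSDE `-dY_r = ∂_q f(r, c_r, X_r, Q_r) dr - Z_r dW_r` with
`Y_τ = ∂_q g(X_τ, Q_τ)`. -/
structure IsBSDESolution {Ω : Type*} {mΩ : MeasurableSpace Ω} (P : Measure Ω) (W : ℝ≥0 → Ω → ℝ)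
    (hW : ∀ s, Measurable (W s)) (f : ℝ → ℝ → ℝ → ℝ → ℝ) (g : ℝ → ℝ → ℝ) (T t q : ℝ)
    (c : ℝ → ℝ) (X Y Z : ℝ → Ω → ℝ) : Prop where
  adapted : ∀ r ∈ Icc t (liqTime T t q c), Measurable[brownianFiltration P W hW r] (Y r)
  continuous : ∀ᵐ ω ∂P, ContinuousOn (fun r => Y r ω) (Icc t (liqTime T t q c))
  progressive : IsStronglyProgressive (brownianFiltration P W hW) Z
  driver_integrable : ∀ᵐ ω ∂P, IntervalIntegrable
    (fun s => deriv (fun q' => f s (c s) (X s ω) q') (inventory T t q c s)) volume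
    t (liqTime T t q c)
  equation : ∀ r ∈ Icc t (liqTime T t q c), IsItoIntegral P W hW r (liqTime T t q c) Z
    (fun ω => deriv (fun q' => g (X (liqTime T t q c) ω) q')
          (inventory T t q c (liqTime T t q c))
        + (∫ s in r..(liqTime T t q c),
            deriv (fun q' => f s (c s) (X s ω) q') (inventory T t q c s))
        - Y r ω)

/-- The Hamiltonian `-π y + f(t, π, x, q)`. -/
def hamiltonian (f : ℝ → ℝ → ℝ → ℝ → ℝ) (t π x q y : ℝ) : ℝ := -π * y + f t π x q

end Terms

/-! ### The example: `dX_r = X_r dW_r`, `f(π, x) = π x`, `g = 0`, rates in `[0, c⁺]` -/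

/-- No drift. -/
def exDrift (_r _x : ℝ) : ℝ := 0

/-- The diffusion coefficient `σ(r, x) = x`. -/
def exVol (_r x : ℝ) : ℝ := x

/-- The running payoff `π x`. -/
def exRunning (_r π x _q : ℝ) : ℝ := π * x

/-- No terminal payoff. -/
def exTerminal (_x _q : ℝ) : ℝ := 0

/-- The optimal control on `[t, T]` from inventory `q` at time `t`. -/
def exControl (cplus T t q : ℝ) (_r : ℝ) : ℝ :=
  if q ≤ cplus * (T - t) then q / (T - t) else cplus

/-- The closed form of `f̄(t, c̄, x, q)`. -/
def exFbar (cplus T t cbar x q : ℝ) : ℝ :=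
  if q ≤ cplus * (T - t) then
    (cbar - exControl cplus T t q t) * x * (if exControl cplus T t q t ≤ cbar then 1 else 0)
  else 0

/-- `𝒢` is the supplementary function of the example: at all `t ∈ [0, T)`, `c̄ ∈ [0, c⁺]`,
`x > 0` and `q > 0`, its value is the one for the problem started at time `t` from `(x, q)`. -/
def IsExSupplementary {Ω : Type*} {mΩ : MeasurableSpace Ω} (P : Measure Ω) (W : ℝ≥0 → Ω → ℝ)
    (hW : ∀ s, Measurable (W s)) (cplus T : ℝ) (𝒢 : ℝ → ℝ → ℝ → ℝ → ℝ) : Prop :=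
  ∀ t ∈ Ico 0 T, ∀ cbar ∈ Icc 0 cplus, ∀ x q : ℝ, 0 < x → 0 < q → ∀ X : ℝ → Ω → ℝ,
    IsSDESolution P W hW exDrift exVol t T x X →
      HasSupplementaryTerm P exRunning exTerminal T t q (exControl cplus T t q) cbar X
        (𝒢 t cbar x q)

end Liquidation

end

/-! Started afresh at `(t, q)`, the optimal control is a constant `k` with `k (T - t) ≤ q`, so it
liquidates exactly at `T`. If `c̄ ≤ k`, the varied control sells less before `T`, both liquidation
times are `T`, and `f̄ = 0` (`hasFbar_zero_of_le`). If `c̄ > k`, then `k < c⁺`, which forces `k (T -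
t) = q`. The variation sells the surplus `(c̄ - k) θ` early and finishes `(c̄ - k) θ / k` before
`T`. On that window the larger control is `k` and the price has mean `x`, so the quotient equals
`(c̄ - k) x` already for every small `θ` (`hasFbar_of_lt`). As `g = 0`, it follows that `𝒢 = -f̄`.

In the BSDE both `∂_q f` and `∂_q g` vanish, so `-Y_t` is an Itô integral over `[t, τ]` and is known
at `t`. Such an integral is orthogonal to bounded variables known at `t`; testing against the sign
of `Y_t` gives `Y_t = 0` almost surely. The Hamiltonian expression becomes `(c̄ - c_t) X_t - f̄(t,
c̄, X_t, Q_t)`. Restarting at `(t, Q_t)` reproduces the same rate (`exControl_inventory`), so the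
expression is zero for `c̄ > c_t` and `(c̄ - c_t) X_t` otherwise, which is nonpositive once `X_t >
0`.

The stochastic input is the Itô isometry, proved on simple processes and passed to the limit, and
the exponential martingale. The latter is shown to solve the price equation by explicit
approximation on a grid. With uniqueness this makes every solution positive; existence is also what
determines `𝒢` at each `(t, x)`, since its defining property says something only where a solution
starts. -/

namespace Liquidation

/-! ### Brownian increments and the augmented filtration -/

section Increments

variable {Ω : Type*} {mΩ : MeasurableSpace Ω} {P : Measure Ω} {W : ℝ≥0 → Ω → ℝ}
  {hWm : ∀ s, Measurable (W s)}

/-- The sets that agree almost surely with a raw event form a σ-algebra, so it suffices to check the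
two families of generators. -/
lemma brownianFiltration_le_eventuallyMeasurable (r : ℝ) :
    brownianFiltration P W hWm r ≤ eventuallyMeasurableSpace
      (⨆ s : ℝ≥0, ⨆ _ : s ≤ r.toNNReal, MeasurableSpace.comap (W s) inferInstance) (ae P) := by
  refine sup_le (fun A hA => ⟨A, hA, EventuallyEq.refl _ _⟩) (MeasurableSpace.generateFrom_le ?_)
  rintro N ⟨-, hN⟩
  exact ⟨∅, @MeasurableSet.empty _ (_), ae_eq_empty.mpr hN⟩

/-- Augmentation does not affect independence: an event can be replaced by a raw one that differs
from it by a null set, and then the Markov property of `W` applies. -/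
lemma indep_brownianFiltration_increments [IsProbabilityMeasure P] (hW : IsPreBrownianReal W P)
    (r : ℝ) :
    Indep (brownianFiltration P W hWm r)
      (MeasurableSpace.comap (fun ω (u : ℝ≥0) => W (r.toNNReal + u) ω - W r.toNNReal ω)
        inferInstance) P := by
  have h := (hW.indepFun_shift r.toNNReal).symm
  rw [IndepFun_iff_Indep] at h
  rw [Indep_iff] at h ⊢
  intro A B hA hB
  obtain ⟨A', hA', hAA'⟩ := brownianFiltration_le_eventuallyMeasurable r A hA
  have hle : (⨆ s : ℝ≥0, ⨆ _ : s ≤ r.toNNReal, MeasurableSpace.comap (W s) inferInstance) ≤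
      MeasurableSpace.comap (fun ω (t : Set.Iic r.toNNReal) => W t ω) inferInstance := by
    refine iSup_le fun s => iSup_le fun hs => ?_
    rintro _ ⟨S, hS, rfl⟩
    exact ⟨(fun x => x ⟨s, hs⟩) ⁻¹' S, measurable_pi_apply _ hS, rfl⟩
  have h2 := h A' B (hle A' hA') hB
  rw [measure_congr hAA', ← h2]
  exact measure_congr (hAA'.inter (ae_eq_refl B))

/-- Two increments are treated jointly because the isometry needs the product of increments over
overlapping intervals. -/
lemma indepFun_increments [IsProbabilityMeasure P] (hW : IsPreBrownianReal W P)
    {l u v : ℝ} (hlu : l ≤ u) (hlv : l ≤ v) {η : Ω → ℝ}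
    (hη : Measurable[brownianFiltration P W hWm l] η) {φ : ℝ × ℝ → ℝ} (hφ : Measurable φ) :
    IndepFun η (fun ω => φ (W u.toNNReal ω - W l.toNNReal ω, W v.toNNReal ω - W l.toNNReal ω))
      P := by
  rw [IndepFun_iff_Indep]
  refine indep_of_indep_of_le_left (indep_of_indep_of_le_right
    (indep_brownianFiltration_increments hW l) ?_) hη.comap_le
  rintro _ ⟨S, hS, rfl⟩
  -- The increment process is indexed by the time elapsed since `l`; the truncated differences are
  -- true ones because `l ≤ u` and `l ≤ v`.
  refine ⟨(fun x : ℝ≥0 → ℝ => φ (x (u.toNNReal - l.toNNReal), x (v.toNNReal - l.toNNReal))) ⁻¹' S,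
    (hφ.comp ((measurable_pi_apply _).prodMk (measurable_pi_apply _))) hS, ?_⟩
  ext ω
  simp only [mem_preimage]
  rw [add_tsub_cancel_of_le (Real.toNNReal_mono hlu), add_tsub_cancel_of_le (Real.toNNReal_mono hlv)]

lemma indepFun_increment [IsProbabilityMeasure P] (hW : IsPreBrownianReal W P)
    {l u : ℝ} (hlu : l ≤ u) {η : Ω → ℝ}
    (hη : Measurable[brownianFiltration P W hWm l] η) {φ : ℝ → ℝ} (hφ : Measurable φ) :
    IndepFun η (fun ω => φ (W u.toNNReal ω - W l.toNNReal ω)) P :=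
  indepFun_increments hW hlu hlu hη (φ := fun x => φ x.1) (hφ.comp measurable_fst)

lemma hasLaw_increment (hW : IsPreBrownianReal W P) {l u : ℝ} (hl : 0 ≤ l) (hlu : l ≤ u) :
    HasLaw (fun ω => W u.toNNReal ω - W l.toNNReal ω) (gaussianReal 0 (u - l).toNNReal) P := by
  have h := hW.hasLaw_sub u.toNNReal l.toNNReal
  have e : nndist u.toNNReal.1 l.toNNReal.1 = (u - l).toNNReal := by
    ext
    rw [coe_nndist, Real.coe_toNNReal _ (sub_nonneg.2 hlu)]
    change dist ((u.toNNReal : ℝ)) (l.toNNReal : ℝ) = _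
    rw [Real.coe_toNNReal _ hl, Real.coe_toNNReal _ (hl.trans hlu), Real.dist_eq,
      abs_of_nonneg (sub_nonneg.2 hlu)]
  rw [e] at h
  exact h

lemma hasGaussianLaw_increment (hW : IsPreBrownianReal W P) {l u : ℝ} (hl : 0 ≤ l) (hlu : l ≤ u) :
    HasGaussianLaw (fun ω => W u.toNNReal ω - W l.toNNReal ω) P :=
  (hasLaw_increment hW hl hlu).hasGaussianLaw

lemma integral_increment (hW : IsPreBrownianReal W P) {l u : ℝ} (hl : 0 ≤ l) (hlu : l ≤ u) :
    ∫ ω, (W u.toNNReal ω - W l.toNNReal ω) ∂P = 0 := by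
  have := (hasLaw_increment hW hl hlu).integral_eq
  rwa [integral_id_gaussianReal] at this

/-- The increments from `l` on form a Brownian motion, so this is its covariance at the elapsed
times `u - l` and `v - l`. -/
lemma integral_increment_mul_increment [IsProbabilityMeasure P] (hW : IsPreBrownianReal W P)
    {l u v : ℝ} (hl : 0 ≤ l) (hlu : l ≤ u) (hlv : l ≤ v) :
    ∫ ω, (W u.toNNReal ω - W l.toNNReal ω) * (W v.toNNReal ω - W l.toNNReal ω) ∂P
      = min u v - l := by
  have h := (hW.shift l.toNNReal).covariance_eval (u.toNNReal - l.toNNReal)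
    (v.toNNReal - l.toNNReal)
  simp only [add_tsub_cancel_of_le (Real.toNNReal_mono hlu),
    add_tsub_cancel_of_le (Real.toNNReal_mono hlv)] at h
  rw [covariance_eq_sub (hasGaussianLaw_increment hW hl hlu).memLp_two
    (hasGaussianLaw_increment hW hl hlv).memLp_two, integral_increment hW hl hlu,
    zero_mul, sub_zero] at h
  refine (show _ = _ from h).trans ?_
  rw [NNReal.coe_min, NNReal.coe_sub (Real.toNNReal_mono hlu),
    NNReal.coe_sub (Real.toNNReal_mono hlv), Real.coe_toNNReal _ hl,
    Real.coe_toNNReal _ (hl.trans hlu), Real.coe_toNNReal _ (hl.trans hlv), min_sub_sub_right]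

lemma measurable_brownian_at {s r : ℝ} (hsr : s ≤ r) :
    Measurable[brownianFiltration P W hWm r] (W s.toNNReal) := by
  rw [measurable_iff_comap_le]
  exact le_sup_of_le_left (le_iSup₂_of_le s.toNNReal (Real.toNNReal_mono hsr) le_rfl)

lemma _root_.Measurable.of_brownianFiltration {r : ℝ} {f : Ω → ℝ}
    (hf : Measurable[brownianFiltration P W hWm r] f) : Measurable f :=
  hf.mono ((brownianFiltration P W hWm).le r) le_rfl

lemma _root_.Measurable.brownianFiltration_mono {s r : ℝ} (hsr : s ≤ r) {f : Ω → ℝ}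
    (hf : Measurable[brownianFiltration P W hWm s] f) :
    Measurable[brownianFiltration P W hWm r] f :=
  hf.mono ((brownianFiltration P W hWm).mono hsr) le_rfl

end Increments

end Liquidation

/-! ### Itô isometry and orthogonality -/

namespace Liquidation

section SimpleProcesses

variable {Ω : Type*} {mΩ : MeasurableSpace Ω} {P : Measure Ω} {W : ℝ≥0 → Ω → ℝ}
  {hWm : ∀ s, Measurable (W s)}

/-- Integrability of `η` is not needed: the product formula for independent variables requires
measurability only, and the increment has mean zero. -/
lemma integral_mul_increment [IsProbabilityMeasure P] (hW : IsPreBrownianReal W P)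
    {l u : ℝ} (hl : 0 ≤ l) (hlu : l ≤ u) {η : Ω → ℝ}
    (hη : Measurable[brownianFiltration P W hWm l] η) :
    ∫ ω, η ω * (W u.toNNReal ω - W l.toNNReal ω) ∂P = 0 := by
  have h := indepFun_increment hW hlu hη measurable_id
  rw [show (fun ω => η ω * (W u.toNNReal ω - W l.toNNReal ω)) =
      fun ω => η ω * id (W u.toNNReal ω - W l.toNNReal ω) from rfl,
    h.integral_fun_mul_eq_mul_integral hη.of_brownianFiltration.aestronglyMeasurable
      ((hWm _).sub (hWm _)).aestronglyMeasurable]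
  simp only [id, integral_increment hW hl hlu, mul_zero]

/-- If `u ≤ l'`, every factor but the last increment is known at `l'`, and the mean vanishes.
Otherwise the first increment is split at `l'`: the part before `l'` is again known there and
contributes zero, and the part after it gives the length of the overlap. -/
lemma integral_coef_increment_mul_coef_increment_of_le [IsProbabilityMeasure P]
    (hW : IsPreBrownianReal W P) {l u l' u' : ℝ} (hl : 0 ≤ l) (hlu : l ≤ u) (hlu' : l' ≤ u')
    (hll' : l ≤ l') {ξ ζ : Ω → ℝ} (hξ : Measurable[brownianFiltration P W hWm l] ξ)
    (hζ : Measurable[brownianFiltration P W hWm l'] ζ) {C : ℝ} (hξC : ∀ ω, |ξ ω| ≤ C)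
    {D : ℝ} (hζD : ∀ ω, |ζ ω| ≤ D) :
    ∫ ω, (ξ ω * (W u.toNNReal ω - W l.toNNReal ω)) *
      (ζ ω * (W u'.toNNReal ω - W l'.toNNReal ω)) ∂P
      = volume.real (Ioc l u ∩ Ioc l' u') * ∫ ω, ξ ω * ζ ω ∂P := by
  have hl' := hl.trans hll'
  have hξ' := hξ.brownianFiltration_mono hll'
  have hinc : ∀ {s r : ℝ}, s ≤ r → r ≤ l' →
      Measurable[brownianFiltration P W hWm l'] (fun ω => W r.toNNReal ω - W s.toNNReal ω) :=
    fun hsr hr => (measurable_brownian_at hr).sub (measurable_brownian_at (hsr.trans hr))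
  rw [Ioc_inter_Ioc, max_eq_right hll']
  rcases le_total u l' with hul' | hul'
  · have h0 := integral_mul_increment hW hl' hlu' ((hξ'.mul (hinc hlu hul')).mul hζ)
    rw [Ioc_eq_empty (by simp [hul']), measureReal_empty, zero_mul, ← h0]
    congr 1 with ω
    simp only [Pi.mul_apply]
    ring
  · have h0 := integral_mul_increment hW hl' hlu' ((hξ'.mul (hinc hll' le_rfl)).mul hζ)
    have hI := indepFun_increments hW hul' hlu' (hξ'.mul hζ) (φ := fun x => x.1 * x.2)
      (measurable_fst.mul measurable_snd)
    have hI' := hI.integral_fun_mul_eq_mul_integral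
      (hξ'.mul hζ).of_brownianFiltration.aestronglyMeasurable
      (((hWm _).sub (hWm _)).mul ((hWm _).sub (hWm _))).aestronglyMeasurable
    simp only [integral_increment_mul_increment hW hl' hul' hlu'] at hI'
    rw [measureReal_def, Real.volume_Ioc, ENNReal.toReal_ofReal (sub_nonneg.2 (le_min hul' hlu')),
      mul_comm]
    have hI'' : ∫ ω, (ξ * ζ) ω * ((W u.toNNReal ω - W l'.toNNReal ω) *
        (W u'.toNNReal ω - W l'.toNNReal ω)) ∂P = (∫ ω, ξ ω * ζ ω ∂P) * (min u u' - l') := hI'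
    rw [← hI'', ← add_zero (∫ ω, (ξ * ζ) ω * _ ∂P), ← h0, ← integral_add]
    · congr 1 with ω
      simp only [Pi.mul_apply]
      ring
    · refine Integrable.bdd_mul (c := C * D)
        ((hasGaussianLaw_increment hW hl' hul').memLp_two.integrable_mul
          (hasGaussianLaw_increment hW hl' hlu').memLp_two)
        (hξ'.mul hζ).of_brownianFiltration.aestronglyMeasurable (ae_of_all _ fun ω => ?_)
      rw [Pi.mul_apply, norm_mul]
      exact mul_le_mul (hξC ω) (hζD ω) (norm_nonneg _) ((abs_nonneg _).trans (hξC ω))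
    · have := Integrable.bdd_mul (c := C * D)
        ((hasGaussianLaw_increment hW hl hll').memLp_two.integrable_mul
          (hasGaussianLaw_increment hW hl' hlu').memLp_two)
        (hξ'.mul hζ).of_brownianFiltration.aestronglyMeasurable (ae_of_all _ fun ω => by
          rw [Pi.mul_apply, norm_mul]
          exact mul_le_mul (hξC ω) (hζD ω) (norm_nonneg _) ((abs_nonneg _).trans (hξC ω)))
      refine this.congr (ae_of_all _ fun ω => ?_)
      simp only [Pi.mul_apply]
      ring

lemma integral_coef_increment_mul_coef_increment [IsProbabilityMeasure P]
    (hW : IsPreBrownianReal W P) {l u l' u' : ℝ} (hl : 0 ≤ l) (hl' : 0 ≤ l') (hlu : l ≤ u)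
    (hlu' : l' ≤ u') {ξ ζ : Ω → ℝ} (hξ : Measurable[brownianFiltration P W hWm l] ξ)
    (hζ : Measurable[brownianFiltration P W hWm l'] ζ) (hξC : ∃ C : ℝ, ∀ ω, |ξ ω| ≤ C)
    (hζD : ∃ D : ℝ, ∀ ω, |ζ ω| ≤ D) :
    ∫ ω, (ξ ω * (W u.toNNReal ω - W l.toNNReal ω)) *
      (ζ ω * (W u'.toNNReal ω - W l'.toNNReal ω)) ∂P
      = volume.real (Ioc l u ∩ Ioc l' u') * ∫ ω, ξ ω * ζ ω ∂P := by
  obtain ⟨C, hC⟩ := hξC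
  obtain ⟨D, hD⟩ := hζD
  rcases le_total l l' with h | h
  · exact integral_coef_increment_mul_coef_increment_of_le hW hl hlu hlu' h hξ hζ hC hD
  · rw [inter_comm]
    simp_rw [mul_comm (ξ _ * _) (ζ _ * _), mul_comm (ξ _) (ζ _)]
    exact integral_coef_increment_mul_coef_increment_of_le hW hl' hlu' hlu h hζ hξ hD hC

lemma integral_sum_mul_sum {α ι : Type*} {mα : MeasurableSpace α} {μ : Measure α} [Fintype ι]
    {f : ι → α → ℝ} (hf : ∀ i, MemLp (f i) 2 μ) :
    ∫ x, (∑ i, f i x) * (∑ i, f i x) ∂μ = ∑ i, ∑ j, ∫ x, f i x * f j x ∂μ := by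
  have h : ∀ i j, Integrable (fun x => f i x * f j x) μ := fun i j => (hf i).integrable_mul (hf j)
  simp_rw [Finset.sum_mul_sum]
  rw [integral_finsetSum _ fun i _ => integrable_finsetSum _ fun j _ => h i j]
  exact Finset.sum_congr rfl fun i _ => integral_finsetSum _ fun j _ => h i j

lemma eLpNorm_le_eLpNorm_add_eLpNorm_sub {α : Type*} {mα : MeasurableSpace α} {μ : Measure α}
    {f g : α → ℝ} (hf : AEStronglyMeasurable f μ) (hg : AEStronglyMeasurable g μ) :
    eLpNorm f 2 μ ≤ eLpNorm g 2 μ + eLpNorm (fun x => f x - g x) 2 μ :=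
  calc eLpNorm f 2 μ = eLpNorm (g + (f - g)) 2 μ := by simp
    _ ≤ _ := eLpNorm_add_le hg (hf.sub hg) one_le_two

lemma eLpNorm_le_eLpNorm_add_eLpNorm_sub' {α : Type*} {mα : MeasurableSpace α} {μ : Measure α}
    {f g : α → ℝ} (hf : AEStronglyMeasurable f μ) (hg : AEStronglyMeasurable g μ) :
    eLpNorm g 2 μ ≤ eLpNorm f 2 μ + eLpNorm (fun x => f x - g x) 2 μ :=
  calc eLpNorm g 2 μ = eLpNorm (f - (f - g)) 2 μ := by simp
    _ ≤ _ := eLpNorm_sub_le hf (hf.sub hg) one_le_two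

namespace SimpleProcess

variable {a b : ℝ}

section Prob

variable (V : SimpleProcess (brownianFiltration P W hWm) a b)

lemma memLp_integral_term (hW : IsPreBrownianReal W P) (ha : 0 ≤ a) (i : Fin V.n) :
    MemLp (fun ω => V.coef i ω * (W (V.right i).toNNReal ω - W (V.left i).toNNReal ω)) 2 P := by
  obtain ⟨C, hC⟩ := V.bounded_coef i
  refine MemLp.of_le_mul (c := C)
    (hasGaussianLaw_increment hW (ha.trans (V.le_left i)) (V.left_le_right i)).memLp_two
    ((V.measurable_coef i).of_brownianFiltration.mul ((hWm _).sub (hWm _))).aestronglyMeasurable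
    (ae_of_all _ fun ω => ?_)
  rw [norm_mul]
  exact mul_le_mul_of_nonneg_right (hC ω) (norm_nonneg _)

lemma memLp_integral (hW : IsPreBrownianReal W P) (ha : 0 ≤ a) : MemLp (V.integral W) 2 P :=
  memLp_finsetSum _ fun i _ => V.memLp_integral_term hW ha i

lemma value_eq_sum (p : ℝ × Ω) :
    V.value p.1 p.2 =
      ∑ i, (Ioc (V.left i) (V.right i)).indicator (1 : ℝ → ℝ) p.1 * V.coef i p.2 := by
  refine Finset.sum_congr rfl fun i _ => ?_
  by_cases h : p.1 ∈ Ioc (V.left i) (V.right i) <;> simp [h]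

lemma memLp_value_term [IsProbabilityMeasure P] (i : Fin V.n) :
    MemLp (fun p : ℝ × Ω => (Ioc (V.left i) (V.right i)).indicator (1 : ℝ → ℝ) p.1 * V.coef i p.2)
      2 ((volume.restrict (Icc a b)).prod P) := by
  obtain ⟨C, hC⟩ := V.bounded_coef i
  refine MemLp.of_bound (((measurable_one.indicator measurableSet_Ioc).comp measurable_fst).mul
    ((V.measurable_coef i).of_brownianFiltration.comp measurable_snd)).aestronglyMeasurable C
    (ae_of_all _ fun p => ?_)
  rw [norm_mul]
  refine (mul_le_mul (b := 1) ?_ (hC p.2) (abs_nonneg _) zero_le_one).trans (one_mul C).le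
  by_cases h : p.1 ∈ Ioc (V.left i) (V.right i) <;> simp [h]

lemma memLp_value [IsProbabilityMeasure P] :
    MemLp (fun p : ℝ × Ω => V.value p.1 p.2) 2 ((volume.restrict (Icc a b)).prod P) := by
  simp_rw [V.value_eq_sum]
  exact memLp_finsetSum _ fun i _ => V.memLp_value_term i

/-- The Itô isometry for simple processes. -/
lemma integral_sq_integral [IsProbabilityMeasure P] (hW : IsPreBrownianReal W P) (ha : 0 ≤ a) :
    ∫ ω, V.integral W ω * V.integral W ω ∂P
      = ∫ p : ℝ × Ω, V.value p.1 p.2 * V.value p.1 p.2 ∂((volume.restrict (Icc a b)).prod P) := by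
  simp_rw [V.value_eq_sum, SimpleProcess.integral]
  rw [integral_sum_mul_sum fun i => V.memLp_integral_term hW ha i,
    integral_sum_mul_sum fun i => V.memLp_value_term i]
  refine Finset.sum_congr rfl fun i _ => Finset.sum_congr rfl fun j _ => ?_
  -- The two double sums agree term by term: each term is the length of the overlap of two intervals
  -- times the mean of the product of the coefficients.
  rw [integral_coef_increment_mul_coef_increment hW (ha.trans (V.le_left i))
    (ha.trans (V.le_left j)) (V.left_le_right i) (V.left_le_right j) (V.measurable_coef i)
    (V.measurable_coef j) (V.bounded_coef i) (V.bounded_coef j)]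
  have e : ∀ p : ℝ × Ω,
      (Ioc (V.left i) (V.right i)).indicator (1 : ℝ → ℝ) p.1 * V.coef i p.2 *
        ((Ioc (V.left j) (V.right j)).indicator (1 : ℝ → ℝ) p.1 * V.coef j p.2) =
      (Ioc (V.left i) (V.right i) ∩ Ioc (V.left j) (V.right j)).indicator (1 : ℝ → ℝ) p.1 *
        (V.coef i p.2 * V.coef j p.2) := by
    intro p
    rw [Set.inter_indicator_one, Pi.mul_apply]
    ring
  simp_rw [e]
  rw [integral_prod_mul (fun s => (Ioc (V.left i) (V.right i) ∩
    Ioc (V.left j) (V.right j)).indicator (1 : ℝ → ℝ) s) (fun ω => V.coef i ω * V.coef j ω)]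
  congr 1
  rw [integral_indicator_one (measurableSet_Ioc.inter measurableSet_Ioc), measureReal_restrict_apply
    (measurableSet_Ioc.inter measurableSet_Ioc)]
  refine congrArg _ (inter_eq_self_of_subset_left fun s hs => ?_).symm
  exact ⟨(V.le_left i).trans hs.1.1.le, hs.1.2.trans (V.right_le i)⟩

lemma eLpNorm_two_eq_of_integral_mul_self_eq {α β : Type*} {mα : MeasurableSpace α}
    {mβ : MeasurableSpace β} {μ : Measure α} {ν : Measure β} {f : α → ℝ} {g : β → ℝ}
    (hf : MemLp f 2 μ) (hg : MemLp g 2 ν) (h : ∫ x, f x * f x ∂μ = ∫ y, g y * g y ∂ν) :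
    eLpNorm f 2 μ = eLpNorm g 2 ν := by
  rw [hf.eLpNorm_eq_integral_rpow_norm (by norm_num) (by norm_num),
    hg.eLpNorm_eq_integral_rpow_norm (by norm_num) (by norm_num)]
  simpa [← sq] using congrArg (fun x => ENNReal.ofReal (x ^ (2⁻¹ : ℝ))) h

lemma eLpNorm_integral [IsProbabilityMeasure P] (hW : IsPreBrownianReal W P) (ha : 0 ≤ a) :
    eLpNorm (V.integral W) 2 P =
      eLpNorm (fun p : ℝ × Ω => V.value p.1 p.2) 2 ((volume.restrict (Icc a b)).prod P) :=
  eLpNorm_two_eq_of_integral_mul_self_eq (V.memLp_integral hW ha) V.memLp_value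
    (V.integral_sq_integral hW ha)

/-- Every interval of the process starts at or after `a`, so `ξ` can be absorbed into each
coefficient. -/
lemma integral_bounded_mul_integral [IsProbabilityMeasure P] (hW : IsPreBrownianReal W P) (ha : 0 ≤ a) {ξ : Ω → ℝ}
    (hξ : Measurable[brownianFiltration P W hWm a] ξ) {C : ℝ} (hC : ∀ ω, |ξ ω| ≤ C) :
    ∫ ω, ξ ω * V.integral W ω ∂P = 0 := by
  simp_rw [SimpleProcess.integral, Finset.mul_sum]
  rw [integral_finsetSum]
  · refine Finset.sum_eq_zero fun i _ => ?_
    rw [← integral_mul_increment hW (ha.trans (V.le_left i)) (V.left_le_right i)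
      ((hξ.brownianFiltration_mono (V.le_left i)).mul (V.measurable_coef i))]
    simp only [Pi.mul_apply, mul_assoc]
  · exact fun i _ => ((V.memLp_integral_term hW ha i).integrable one_le_two).bdd_mul (c := C)
      hξ.of_brownianFiltration.aestronglyMeasurable (ae_of_all _ hC)

end Prob

/-- The difference of two simple processes. -/
def sub {𝓕 : Filtration ℝ mΩ} (U V : SimpleProcess 𝓕 a b) : SimpleProcess 𝓕 a b where
  n := U.n + V.n
  left := Fin.addCases U.left V.left
  right := Fin.addCases U.right V.right
  coef := Fin.addCases U.coef fun i ω => -V.coef i ω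
  le_left i := by
    refine Fin.addCases (fun i => ?_) (fun i => ?_) i
    · simpa using U.le_left i
    · simpa using V.le_left i
  left_le_right i := by
    refine Fin.addCases (fun i => ?_) (fun i => ?_) i
    · simpa using U.left_le_right i
    · simpa using V.left_le_right i
  right_le i := by
    refine Fin.addCases (fun i => ?_) (fun i => ?_) i
    · simpa using U.right_le i
    · simpa using V.right_le i
  measurable_coef i := by
    refine Fin.addCases (fun i => ?_) (fun i => ?_) i
    · rw [Fin.addCases_left, Fin.addCases_left]
      exact U.measurable_coef i
    · rw [Fin.addCases_right, Fin.addCases_right]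
      exact (V.measurable_coef i).neg
  bounded_coef i := by
    refine Fin.addCases (fun i => ?_) (fun i => ?_) i
    · simpa using U.bounded_coef i
    · simpa using V.bounded_coef i

lemma value_sub {𝓕 : Filtration ℝ mΩ} (U V : SimpleProcess 𝓕 a b) (r : ℝ) (ω : Ω) :
    (U.sub V).value r ω = U.value r ω - V.value r ω := by
  unfold value
  refine (Fin.sum_univ_add (a := U.n) (b := V.n) _).trans ?_
  simp only [sub, Fin.addCases_left, Fin.addCases_right, sub_eq_add_neg, ← Finset.sum_neg_distrib]
  congr 1
  refine Finset.sum_congr rfl fun i _ => ?_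
  by_cases h : r ∈ Ioc (V.left i) (V.right i) <;> simp [h]

lemma integral_sub {𝓕 : Filtration ℝ mΩ} (U V : SimpleProcess 𝓕 a b) (ω : Ω) :
    (U.sub V).integral W ω = U.integral W ω - V.integral W ω := by
  unfold integral
  refine (Fin.sum_univ_add (a := U.n) (b := V.n) _).trans ?_
  simp only [sub, Fin.addCases_left, Fin.addCases_right]
  rw [sub_eq_add_neg, ← Finset.sum_neg_distrib]
  simp

end SimpleProcess

section Ito

variable {a b : ℝ} {H H' : ℝ → Ω → ℝ} {I I' : Ω → ℝ}

/-- This feeds the uniqueness argument, where the difference of two solutions has to be an Itô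
integral. -/
lemma IsItoIntegral.sub [IsProbabilityMeasure P] (hW : IsPreBrownianReal W P) (ha : 0 ≤ a)
    (h : IsItoIntegral P W hWm a b H I) (h' : IsItoIntegral P W hWm a b H' I') :
    IsItoIntegral P W hWm a b (fun r ω => H r ω - H' r ω) (fun ω => I ω - I' ω) := by
  obtain ⟨hH, hI, V, hV1, hV2⟩ := h
  obtain ⟨hH', hI', V', hV1', hV2'⟩ := h'
  refine ⟨hH.sub hH', hI.sub hI', fun n => (V n).sub (V' n), ?_, ?_⟩
  · refine tendsto_of_tendsto_of_tendsto_of_le_of_le tendsto_const_nhds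
      (by simpa using hV1.add hV1') (fun _ => zero_le) fun n => ?_
    refine le_trans (le_of_eq ?_) (eLpNorm_sub_le (p := 2)
      (hH.sub (V n).memLp_value).aestronglyMeasurable
      (hH'.sub (V' n).memLp_value).aestronglyMeasurable one_le_two)
    congr 1 with p
    simp only [SimpleProcess.value_sub, Pi.sub_apply]
    ring
  · refine tendsto_of_tendsto_of_tendsto_of_le_of_le tendsto_const_nhds
      (by simpa using hV2.add hV2') (fun _ => zero_le) fun n => ?_
    refine le_trans (le_of_eq ?_) (eLpNorm_sub_le (p := 2)
      (hI.sub ((V n).memLp_integral hW ha)).aestronglyMeasurable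
      (hI'.sub ((V' n).memLp_integral hW ha)).aestronglyMeasurable one_le_two)
    congr 1 with ω
    simp only [SimpleProcess.integral_sub, Pi.sub_apply]
    ring

/-- The Itô isometry. -/
lemma IsItoIntegral.eLpNorm_eq [IsProbabilityMeasure P] (hW : IsPreBrownianReal W P) (ha : 0 ≤ a)
    (h : IsItoIntegral P W hWm a b H I) :
    eLpNorm I 2 P =
      eLpNorm (fun p : ℝ × Ω => H p.1 p.2) 2 ((volume.restrict (Icc a b)).prod P) := by
  obtain ⟨hH, hI, V, hV1, hV2⟩ := h
  have hV1' := fun n => (V n).memLp_value.aestronglyMeasurable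
  have hV2' := fun n => ((V n).memLp_integral hW ha).aestronglyMeasurable
  -- By the isometry for `V n`, the norms of `I` and `H` are both close to one common number; the
  -- sum of the two approximation errors bounds their difference and tends to zero.
  have hz := hV1.add hV2
  rw [add_zero] at hz
  refine le_antisymm ?_ ?_
  · have hz' := hz.const_add (eLpNorm (fun p : ℝ × Ω => H p.1 p.2) 2
      ((volume.restrict (Icc a b)).prod P))
    rw [add_zero] at hz'
    refine ge_of_tendsto' hz' fun n => ?_
    refine (eLpNorm_le_eLpNorm_add_eLpNorm_sub hI.aestronglyMeasurable (hV2' n)).trans ?_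
    rw [(V n).eLpNorm_integral hW ha, ← add_assoc]
    gcongr
    exact eLpNorm_le_eLpNorm_add_eLpNorm_sub' hH.aestronglyMeasurable (hV1' n)
  · have hz' := hz.const_add (eLpNorm I 2 P)
    rw [add_zero] at hz'
    refine ge_of_tendsto' hz' fun n => ?_
    refine (eLpNorm_le_eLpNorm_add_eLpNorm_sub hH.aestronglyMeasurable (hV1' n)).trans ?_
    rw [← (V n).eLpNorm_integral hW ha,
      add_comm (eLpNorm _ 2 (Measure.prod _ _)) (eLpNorm _ 2 P), ← add_assoc]
    gcongr
    exact eLpNorm_le_eLpNorm_add_eLpNorm_sub' hI.aestronglyMeasurable (hV2' n)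

/-- An Itô integral over `[a, b]` is orthogonal to the bounded random variables known at `a`. -/
lemma IsItoIntegral.integral_bounded_mul [IsProbabilityMeasure P] (hW : IsPreBrownianReal W P)
    (ha : 0 ≤ a) (h : IsItoIntegral P W hWm a b H I) {ξ : Ω → ℝ}
    (hξ : Measurable[brownianFiltration P W hWm a] ξ) {C : ℝ} (hC : ∀ ω, |ξ ω| ≤ C) :
    ∫ ω, ξ ω * I ω ∂P = 0 := by
  obtain ⟨-, hI, V, -, hV⟩ := h
  have hVi := fun n => (V n).memLp_integral hW ha
  have hint : ∀ {J : Ω → ℝ}, MemLp J 2 P → Integrable (fun ω => ξ ω * J ω) P := fun hJ =>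
    (hJ.integrable one_le_two).bdd_mul (c := C)
      hξ.of_brownianFiltration.aestronglyMeasurable (ae_of_all _ hC)
  have h1 : Tendsto (fun n => ENNReal.ofReal C * eLpNorm (fun ω => I ω - (V n).integral W ω) 2 P)
      atTop (𝓝 0) := by
    simpa using ENNReal.Tendsto.const_mul hV (Or.inr ENNReal.ofReal_ne_top)
  have h2 : ∀ n, ‖∫ ω, ξ ω * I ω ∂P‖ₑ ≤
      ENNReal.ofReal C * eLpNorm (fun ω => I ω - (V n).integral W ω) 2 P := by
    intro n
    have e : ∫ ω, ξ ω * I ω ∂P = ∫ ω, ξ ω * (I ω - (V n).integral W ω) ∂P := by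
      simp_rw [mul_sub]
      rw [MeasureTheory.integral_sub (hint hI) (hint (hVi n)),
        (V n).integral_bounded_mul_integral hW ha hξ hC, sub_zero]
    rw [e]
    refine (enorm_integral_le_lintegral_enorm _).trans ?_
    rw [← eLpNorm_one_eq_lintegral_enorm]
    refine (eLpNorm_le_mul_eLpNorm_of_ae_le_mul (c := C) (g := fun ω => I ω - (V n).integral W ω)
      (ae_of_all _ fun ω => ?_) 1).trans ?_
    · rw [norm_mul]
      exact mul_le_mul_of_nonneg_right (hC ω) (norm_nonneg _)
    · gcongr
      exact eLpNorm_le_eLpNorm_of_exponent_le one_le_two (hI.sub (hVi n)).aestronglyMeasurable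
  have h3 := ge_of_tendsto' h1 h2
  simpa using h3

lemma IsItoIntegral.integral_eq_zero [IsProbabilityMeasure P] (hW : IsPreBrownianReal W P)
    (ha : 0 ≤ a) (h : IsItoIntegral P W hWm a b H I) : ∫ ω, I ω ∂P = 0 := by
  have := h.integral_bounded_mul hW ha (ξ := fun _ => 1) measurable_const (C := 1) (by simp)
  simpa using this

/-- A random variable known at `a` whose negative is an Itô integral over `[a, b]` vanishes. -/
lemma IsItoIntegral.ae_eq_zero_of_neg_adapted [IsProbabilityMeasure P]
    (hW : IsPreBrownianReal W P) (ha : 0 ≤ a) {Y : Ω → ℝ}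
    (hY : Measurable[brownianFiltration P W hWm a] Y)
    (h : IsItoIntegral P W hWm a b H (fun ω => -Y ω)) : Y =ᵐ[P] 0 := by
  have hsign : Measurable Real.sign := by
    unfold Real.sign
    exact Measurable.ite measurableSet_Iio measurable_const
      (Measurable.ite measurableSet_Ioi measurable_const measurable_const)
  -- The sign of `Y` is bounded and known at `a`; tested against `-Y` it gives minus the mean of
  -- `|Y|`.
  have h1 := h.integral_bounded_mul hW ha (ξ := fun ω => Real.sign (Y ω)) (hsign.comp hY)
    (C := 1) (fun ω => by rcases Real.sign_apply_eq (Y ω) with h | h | h <;> simp [h])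
  have h2 : ∫ ω, |Y ω| ∂P = 0 := by
    rw [← neg_eq_zero, ← MeasureTheory.integral_neg, ← h1]
    congr 1 with ω
    rcases lt_trichotomy (Y ω) 0 with h | h | h
    · rw [Real.sign_of_neg h, abs_of_neg h]; ring
    · simp [h]
    · rw [Real.sign_of_pos h, abs_of_pos h]; ring
  have hYi : Integrable Y P := by simpa using (h.2.1.integrable one_le_two).neg
  rw [integral_eq_zero_iff_of_nonneg (fun ω => abs_nonneg _) hYi.abs] at h2
  filter_upwards [h2] with ω hω using abs_eq_zero.1 hω

end Ito

end SimpleProcesses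

end Liquidation

/-! ### Gaussian moments and martingale transforms -/

namespace Liquidation

section GaussianMoments

variable {Ω : Type*} {mΩ : MeasurableSpace Ω} {P : Measure Ω} {D : Ω → ℝ} {v : ℝ≥0}

lemma integrable_exp_mul_of_hasLaw (h : HasLaw D (gaussianReal 0 v) P) (k : ℝ) :
    Integrable (fun ω => Real.exp (k * D ω)) P := by
  have hi : Integrable (fun y => Real.exp (k * y)) (P.map D) := by
    rw [h.map_eq]
    exact integrable_exp_mul_gaussianReal k
  exact hi.comp_aemeasurable h.aemeasurable

lemma integral_exp_mul_of_hasLaw (h : HasLaw D (gaussianReal 0 v) P) (k : ℝ) :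
    ∫ ω, Real.exp (k * D ω) ∂P = Real.exp (v * k ^ 2 / 2) := by
  have := mgf_gaussianReal h.map_eq k
  rwa [zero_mul, zero_add] at this

/-- This is the derivative at `k = 1` of the moment generating function `exp (v k² / 2)`. -/
lemma integral_mul_exp_of_hasLaw (h : HasLaw D (gaussianReal 0 v) P) :
    ∫ ω, D ω * Real.exp (D ω) ∂P = v * Real.exp (v / 2) := by
  have huniv : integrableExpSet D P = univ :=
    eq_univ_of_forall fun k => integrable_exp_mul_of_hasLaw h k
  have h1 := hasDerivAt_mgf (X := D) (μ := P) (t := 1) (by rw [huniv, interior_univ]; trivial)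
  have h2 : mgf D P = fun k => Real.exp (v * k ^ 2 / 2) :=
    funext fun k => integral_exp_mul_of_hasLaw h k
  have h3 : HasDerivAt (fun k : ℝ => Real.exp (v * k ^ 2 / 2)) (Real.exp (v / 2) * v) 1 := by
    have : HasDerivAt (fun k : ℝ => (v : ℝ) * k ^ 2 / 2) (v : ℝ) 1 := by
      refine (((hasDerivAt_pow 2 (1 : ℝ)).const_mul (v : ℝ)).div_const 2).congr_deriv ?_
      norm_num
    refine this.exp.congr_deriv ?_
    norm_num
  rw [h2] at h1
  have h4 := h1.unique h3
  simp only [one_mul] at h4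
  rw [h4, mul_comm]

lemma integral_sq_of_hasLaw (h : HasLaw D (gaussianReal 0 v) P) :
    ∫ ω, D ω ^ 2 ∂P = v := by
  have h1 := h.variance_eq
  rw [variance_id_gaussianReal, variance_of_integral_eq_zero h.aemeasurable
    (by rw [h.integral_eq, integral_id_gaussianReal])] at h1
  exact h1

end GaussianMoments

section Orthogonality

variable {Ω : Type*} {mΩ : MeasurableSpace Ω} {P : Measure Ω} {W : ℝ≥0 → Ω → ℝ}
  {hWm : ∀ s, Measurable (W s)}

lemma integral_mul_comp_increment [IsProbabilityMeasure P] (hW : IsPreBrownianReal W P)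
    {l u : ℝ} (hlu : l ≤ u) {η : Ω → ℝ}
    (hη : Measurable[brownianFiltration P W hWm l] η) {ψ : ℝ → ℝ} (hψ : Measurable ψ) :
    ∫ ω, η ω * ψ (W u.toNNReal ω - W l.toNNReal ω) ∂P =
      (∫ ω, η ω ∂P) * ∫ ω, ψ (W u.toNNReal ω - W l.toNNReal ω) ∂P :=
  (indepFun_increment hW hlu hη hψ).integral_fun_mul_eq_mul_integral
    hη.of_brownianFiltration.aestronglyMeasurable
    (hψ.comp ((hWm _).sub (hWm _))).aestronglyMeasurable

lemma memLp_mul_comp_increment [IsProbabilityMeasure P] (hW : IsPreBrownianReal W P)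
    {l u : ℝ} (hlu : l ≤ u) {η : Ω → ℝ}
    (hη : Measurable[brownianFiltration P W hWm l] η) (hη2 : MemLp η 2 P)
    {ψ : ℝ → ℝ} (hψ : Measurable ψ)
    (hψ2 : MemLp (fun ω => ψ (W u.toNNReal ω - W l.toNNReal ω)) 2 P) :
    MemLp (fun ω => η ω * ψ (W u.toNNReal ω - W l.toNNReal ω)) 2 P := by
  have hm : AEStronglyMeasurable
      (fun ω => η ω * ψ (W u.toNNReal ω - W l.toNNReal ω)) P :=
    (hη.of_brownianFiltration.mul (hψ.comp ((hWm _).sub (hWm _)))).aestronglyMeasurable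
  rw [memLp_two_iff_integrable_sq hm]
  have h := indepFun_increment hW hlu (hη.pow_const 2) (hψ.pow_const 2)
  simp_rw [mul_pow]
  exact h.integrable_mul hη2.integrable_sq hψ2.integrable_sq

/-- A martingale transform on a grid: orthogonality of the terms. -/
lemma integral_sq_sum_mul_comp_increment [IsProbabilityMeasure P] (hW : IsPreBrownianReal W P)
    {τ : ℕ → ℝ} (hτ : Monotone τ) {η : ℕ → Ω → ℝ} {ψ : ℕ → ℝ → ℝ}
    (hη : ∀ i, Measurable[brownianFiltration P W hWm (τ i)] (η i)) (hη2 : ∀ i, MemLp (η i) 2 P)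
    (hψ : ∀ i, Measurable (ψ i))
    (hψ2 : ∀ i, MemLp (fun ω => ψ i (W (τ (i + 1)).toNNReal ω - W (τ i).toNNReal ω)) 2 P)
    (hψ0 : ∀ i, ∫ ω, ψ i (W (τ (i + 1)).toNNReal ω - W (τ i).toNNReal ω) ∂P = 0) (n : ℕ) :
    Measurable[brownianFiltration P W hWm (τ n)] (fun ω => ∑ i ∈ Finset.range n,
      η i ω * ψ i (W (τ (i + 1)).toNNReal ω - W (τ i).toNNReal ω)) ∧
    MemLp (fun ω => ∑ i ∈ Finset.range n,
      η i ω * ψ i (W (τ (i + 1)).toNNReal ω - W (τ i).toNNReal ω)) 2 P ∧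
    ∫ ω, (∑ i ∈ Finset.range n,
      η i ω * ψ i (W (τ (i + 1)).toNNReal ω - W (τ i).toNNReal ω)) ^ 2 ∂P =
      ∑ i ∈ Finset.range n, (∫ ω, η i ω ^ 2 ∂P) *
        ∫ ω, ψ i (W (τ (i + 1)).toNNReal ω - W (τ i).toNNReal ω) ^ 2 ∂P := by
  induction n with
  | zero => simp
  | succ n ih =>
    obtain ⟨ih1, ih2, ih3⟩ := ih
    have hstep : τ n ≤ τ (n + 1) := hτ n.le_succ
    have hterm := memLp_mul_comp_increment hW hstep (hη n) (hη2 n) (hψ n) (hψ2 n)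
    simp_rw [Finset.sum_range_succ]
    refine ⟨?_, ih2.add hterm, ?_⟩
    · exact (ih1.brownianFiltration_mono hstep).add
        (((hη n).brownianFiltration_mono hstep).mul ((hψ n).comp
          ((measurable_brownian_at le_rfl).sub (measurable_brownian_at hstep))))
    · set S : Ω → ℝ := fun ω => ∑ i ∈ Finset.range n,
        η i ω * ψ i (W (τ (i + 1)).toNNReal ω - W (τ i).toNNReal ω) with hS
      have e : ∀ ω, (S ω + η n ω * ψ n (W (τ (n + 1)).toNNReal ω - W (τ n).toNNReal ω)) ^ 2 =
          (S ω ^ 2 + 2 * (S ω * (η n ω * ψ n (W (τ (n + 1)).toNNReal ω - W (τ n).toNNReal ω)))) +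
          (η n ω * ψ n (W (τ (n + 1)).toNNReal ω - W (τ n).toNNReal ω)) ^ 2 := fun ω => by ring
      -- The factor `S * η n` is known at `τ n`, and the last factor is independent of it with mean
      -- zero.
      have hcross : ∫ ω, S ω * (η n ω * ψ n (W (τ (n + 1)).toNNReal ω - W (τ n).toNNReal ω)) ∂P
          = 0 := by
        have := integral_mul_comp_increment hW hstep (ih1.mul (hη n)) (hψ n)
        rw [hψ0 n, mul_zero] at this
        rw [← this]
        refine integral_congr_ae (ae_of_all _ fun ω => ?_)
        simp only [Pi.mul_apply, S]
        ring
      have hsq : ∫ ω, (η n ω * ψ n (W (τ (n + 1)).toNNReal ω - W (τ n).toNNReal ω)) ^ 2 ∂P =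
          (∫ ω, η n ω ^ 2 ∂P) *
            ∫ ω, ψ n (W (τ (n + 1)).toNNReal ω - W (τ n).toNNReal ω) ^ 2 ∂P := by
        simp_rw [mul_pow]
        exact integral_mul_comp_increment hW hstep ((hη n).pow_const 2) ((hψ n).pow_const 2)
      have hi : Integrable (fun ω => 2 * (S ω *
          (η n ω * ψ n (W (τ (n + 1)).toNNReal ω - W (τ n).toNNReal ω)))) P :=
        (ih2.integrable_mul hterm).const_mul 2
      refine (integral_congr_ae (ae_of_all _ e)).trans ?_
      have hi' : Integrable (fun ω => S ω ^ 2 + 2 * (S ω *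
          (η n ω * ψ n (W (τ (n + 1)).toNNReal ω - W (τ n).toNNReal ω)))) P :=
        ih2.integrable_sq.add hi
      rw [integral_add hi' hterm.integrable_sq,
        integral_add ih2.integrable_sq hi, integral_const_mul, hcross, hsq, ih3]
      ring

end Orthogonality

/-! ### Moments and measurability of the exponential martingale -/

section Exponential

variable {Ω : Type*} {mΩ : MeasurableSpace Ω} {P : Measure Ω} {W : ℝ≥0 → Ω → ℝ}
  {hWm : ∀ s, Measurable (W s)} {t x : ℝ}

/-- The exponential martingale `x exp(W_r - W_t - (r - t) / 2)`. -/
noncomputable def expMartingale (W : ℝ≥0 → Ω → ℝ) (t x r : ℝ) (ω : Ω) : ℝ :=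
  x * Real.exp (W r.toNNReal ω - W t.toNNReal ω - (r - t) / 2)

lemma expMartingale_pos (hx : 0 < x) (r : ℝ) (ω : Ω) : 0 < expMartingale W t x r ω :=
  mul_pos hx (Real.exp_pos _)

lemma expMartingale_self (ω : Ω) : expMartingale W t x t ω = x := by
  simp [expMartingale]

lemma expMartingale_eq_mul (s r : ℝ) (ω : Ω) : expMartingale W t x r ω =
    expMartingale W t x s ω * Real.exp ((W r.toNNReal ω - W s.toNNReal ω) - (r - s) / 2) := by
  rw [expMartingale, expMartingale, mul_assoc, ← Real.exp_add]
  ring_nf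

lemma measurable_expMartingale {r : ℝ} (htr : t ≤ r) :
    Measurable[brownianFiltration P W hWm r] (expMartingale W t x r) :=
  (Real.measurable_exp.comp (((measurable_brownian_at le_rfl).sub
    (measurable_brownian_at htr)).sub_const _)).const_mul _

lemma expMartingale_pow (k : ℕ) (r : ℝ) (ω : Ω) : expMartingale W t x r ω ^ k =
    x ^ k * Real.exp (-(k * (r - t) / 2)) *
      Real.exp (k * (W r.toNNReal ω - W t.toNNReal ω)) := by
  rw [expMartingale, mul_pow, ← Real.exp_nat_mul, mul_assoc, ← Real.exp_add]
  ring_nf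

lemma integrable_expMartingale_pow (hW : IsPreBrownianReal W P) (ht : 0 ≤ t) {r : ℝ}
    (htr : t ≤ r) (k : ℕ) : Integrable (fun ω => expMartingale W t x r ω ^ k) P := by
  simp_rw [expMartingale_pow]
  exact (integrable_exp_mul_of_hasLaw (hasLaw_increment hW ht htr) k).const_mul _

lemma integral_expMartingale_pow (hW : IsPreBrownianReal W P) (ht : 0 ≤ t) {r : ℝ}
    (htr : t ≤ r) (k : ℕ) : ∫ ω, expMartingale W t x r ω ^ k ∂P =
      x ^ k * Real.exp ((k ^ 2 - k) / 2 * (r - t)) := by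
  simp_rw [expMartingale_pow]
  rw [integral_const_mul, integral_exp_mul_of_hasLaw (hasLaw_increment hW ht htr),
    Real.coe_toNNReal _ (sub_nonneg.2 htr), mul_assoc, ← Real.exp_add]
  ring_nf

lemma memLp_expMartingale (hWm : ∀ s, Measurable (W s)) (hW : IsPreBrownianReal W P)
    (ht : 0 ≤ t) {r : ℝ} (htr : t ≤ r) : MemLp (expMartingale W t x r) 2 P := by
  rw [memLp_two_iff_integrable_sq (measurable_expMartingale (P := P) (hWm := hWm)
    htr).of_brownianFiltration.aestronglyMeasurable]
  exact integrable_expMartingale_pow hW ht htr 2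

/-- The error of the first-order expansion of an exponential increment. -/
noncomputable def expRemainder (h d : ℝ) : ℝ := Real.exp (d - h / 2) - 1 - d

lemma measurable_expRemainder (h : ℝ) : Measurable (expRemainder h) := by
  unfold expRemainder
  fun_prop

lemma exp_sub_half (h d : ℝ) : Real.exp (d - h / 2) = Real.exp (-(h / 2)) * Real.exp (1 * d) := by
  rw [← Real.exp_add]; ring_nf

section Increment

variable {D : Ω → ℝ} {h : ℝ}

lemma memLp_exp_sub_of_hasLaw (hD : HasLaw D (gaussianReal 0 h.toNNReal) P) :
    MemLp (fun ω => Real.exp (D ω - h / 2)) 2 P := by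
  have hm : AEStronglyMeasurable (fun ω => Real.exp (D ω - h / 2)) P :=
    (Real.measurable_exp.comp_aemeasurable (hD.aemeasurable.sub_const _)).aestronglyMeasurable
  rw [memLp_two_iff_integrable_sq hm]
  refine ((integrable_exp_mul_of_hasLaw hD 2).const_mul (Real.exp (-h))).congr
    (ae_of_all _ fun ω => ?_)
  simp only
  rw [← Real.exp_nat_mul, ← Real.exp_add]
  norm_num
  ring

lemma integral_exp_sub_of_hasLaw (h0 : 0 ≤ h) (hD : HasLaw D (gaussianReal 0 h.toNNReal) P) :
    ∫ ω, Real.exp (D ω - h / 2) ∂P = 1 := by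
  simp_rw [exp_sub_half]
  rw [integral_const_mul, integral_exp_mul_of_hasLaw hD, Real.coe_toNNReal _ h0, ← Real.exp_add]
  simp

lemma integral_exp_sub_sq_of_hasLaw (h0 : 0 ≤ h) (hD : HasLaw D (gaussianReal 0 h.toNNReal) P) :
    ∫ ω, Real.exp (D ω - h / 2) ^ 2 ∂P = Real.exp h := by
  have e : ∀ ω, Real.exp (D ω - h / 2) ^ 2 = Real.exp (-h) * Real.exp (2 * D ω) := fun ω => by
    rw [← Real.exp_nat_mul, ← Real.exp_add]
    norm_num
    ring
  simp_rw [e]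
  rw [integral_const_mul, integral_exp_mul_of_hasLaw hD, Real.coe_toNNReal _ h0, ← Real.exp_add]
  ring_nf

variable [IsProbabilityMeasure P]

lemma integral_exp_sub_sub_one_sq_of_hasLaw (h0 : 0 ≤ h)
    (hD : HasLaw D (gaussianReal 0 h.toNNReal) P) :
    ∫ ω, (Real.exp (D ω - h / 2) - 1) ^ 2 ∂P = Real.exp h - 1 := by
  have hm := memLp_exp_sub_of_hasLaw hD
  have e : ∀ ω, (Real.exp (D ω - h / 2) - 1) ^ 2 =
      Real.exp (D ω - h / 2) ^ 2 - (2 * Real.exp (D ω - h / 2) - 1) := fun ω => by ring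
  simp_rw [e]
  have h1 := hm.integrable one_le_two
  have h2 : Integrable (fun ω => 2 * Real.exp (D ω - h / 2) - 1) P :=
    (h1.const_mul 2).sub (integrable_const 1)
  rw [integral_sub hm.integrable_sq h2,
    integral_sub (h1.const_mul 2) (integrable_const 1), integral_const_mul,
    integral_exp_sub_of_hasLaw h0 hD, integral_exp_sub_sq_of_hasLaw h0 hD]
  simp
  ring

lemma memLp_expRemainder (hD : HasLaw D (gaussianReal 0 h.toNNReal) P) :
    MemLp (fun ω => expRemainder h (D ω)) 2 P :=
  ((memLp_exp_sub_of_hasLaw hD).sub (memLp_const 1)).sub hD.hasGaussianLaw.memLp_two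

lemma integral_expRemainder (h0 : 0 ≤ h) (hD : HasLaw D (gaussianReal 0 h.toNNReal) P) :
    ∫ ω, expRemainder h (D ω) ∂P = 0 := by
  have h1 := (memLp_exp_sub_of_hasLaw hD).integrable one_le_two
  have h2 : Integrable (fun ω => Real.exp (D ω - h / 2) - 1) P := h1.sub (integrable_const 1)
  unfold expRemainder
  rw [integral_sub h2 hD.hasGaussianLaw.integrable,
    integral_sub h1 (integrable_const 1), integral_exp_sub_of_hasLaw h0 hD, hD.integral_eq,
    integral_id_gaussianReal]
  simp

/-- With `E = exp (D - h / 2)`, the means of `(E - 1)²`, `D²` and `D E` are `exp h - 1`, `h` and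
`h`. The value is of order `h²`, so such errors, summed over a grid of mesh `h`, remain of order
`h`. -/
lemma integral_expRemainder_sq (h0 : 0 ≤ h) (hD : HasLaw D (gaussianReal 0 h.toNNReal) P) :
    ∫ ω, expRemainder h (D ω) ^ 2 ∂P = Real.exp h - 1 - h := by
  have hm := memLp_exp_sub_of_hasLaw hD
  have hD2 := hD.hasGaussianLaw.memLp_two
  have e : ∀ ω, expRemainder h (D ω) ^ 2 =
      (Real.exp (D ω - h / 2) - 1) ^ 2 +
        (D ω ^ 2 + (2 * D ω - 2 * Real.exp (-(h / 2)) * (D ω * Real.exp (D ω)))) := fun ω => by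
    rw [expRemainder, exp_sub_half, one_mul]
    ring
  have hi : Integrable (fun ω => D ω * Real.exp (D ω)) P := by
    refine ((hD2.integrable_mul hm).const_mul (Real.exp (h / 2))).congr (ae_of_all _ fun ω => ?_)
    simp only [Pi.mul_apply]
    rw [mul_left_comm, ← Real.exp_add]
    ring_nf
  have hi1 := hD2.integrable one_le_two
  simp_rw [e]
  have hi2 : Integrable (fun ω => 2 * D ω - 2 * Real.exp (-(h / 2)) * (D ω * Real.exp (D ω))) P :=
    (hi1.const_mul 2).sub (hi.const_mul _)
  have hi3 : Integrable (fun ω => D ω ^ 2 +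
      (2 * D ω - 2 * Real.exp (-(h / 2)) * (D ω * Real.exp (D ω)))) P := hD2.integrable_sq.add hi2
  have hi4 : Integrable (fun ω => (Real.exp (D ω - h / 2) - 1) ^ 2) P :=
    (hm.sub (memLp_const 1)).integrable_sq
  rw [integral_add hi4 hi3, integral_add hD2.integrable_sq hi2,
    integral_sub (hi1.const_mul 2) (hi.const_mul _), integral_const_mul, integral_const_mul,
    integral_exp_sub_sub_one_sq_of_hasLaw h0 hD, integral_sq_of_hasLaw hD,
    integral_mul_exp_of_hasLaw hD, hD.integral_eq, integral_id_gaussianReal,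
    Real.coe_toNNReal _ h0]
  have : Real.exp (-(h / 2)) * Real.exp (h / 2) = 1 := by rw [← Real.exp_add]; simp
  linear_combination (-2 * h) * this

end Increment

lemma integral_expMartingale_sub_sq [IsProbabilityMeasure P] (hWm : ∀ s, Measurable (W s))
    (hW : IsPreBrownianReal W P) (ht : 0 ≤ t) {s r : ℝ} (hts : t ≤ s) (hsr : s ≤ r) :
    ∫ ω, (expMartingale W t x r ω - expMartingale W t x s ω) ^ 2 ∂P =
      x ^ 2 * Real.exp (s - t) * (Real.exp (r - s) - 1) := by
  have e : ∀ ω, (expMartingale W t x r ω - expMartingale W t x s ω) ^ 2 =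
      expMartingale W t x s ω ^ 2 *
        (Real.exp ((W r.toNNReal ω - W s.toNNReal ω) - (r - s) / 2) - 1) ^ 2 := fun ω => by
    rw [expMartingale_eq_mul s r]
    ring
  simp_rw [e]
  have h := integral_mul_comp_increment hW hsr
    ((measurable_expMartingale (P := P) (hWm := hWm) (x := x) hts).pow_const 2)
    (ψ := fun d => (Real.exp (d - (r - s) / 2) - 1) ^ 2) (by fun_prop)
  rw [integral_expMartingale_pow hW ht hts 2, integral_exp_sub_sub_one_sq_of_hasLaw
    (sub_nonneg.2 hsr) (hasLaw_increment hW (ht.trans hts) hsr)] at h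
  refine h.trans ?_
  norm_num

/-- The excess over a level is small in `L²`. -/
lemma integral_expMartingale_excess_sq_le (hWm : ∀ s, Measurable (W s))
    (hW : IsPreBrownianReal W P) (hx : 0 < x)
    (ht : 0 ≤ t) {r : ℝ} (htr : t ≤ r) {M : ℝ} (hM : 0 < M) :
    MemLp (fun ω => expMartingale W t x r ω - min (expMartingale W t x r ω) M) 2 P ∧
    ∫ ω, (expMartingale W t x r ω - min (expMartingale W t x r ω) M) ^ 2 ∂P ≤
      x ^ 4 * Real.exp (6 * (r - t)) / M ^ 2 := by
  have hm := (measurable_expMartingale (P := P) (hWm := hWm) (x := x) htr).of_brownianFiltration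
  have hle : ∀ ω, |expMartingale W t x r ω - min (expMartingale W t x r ω) M| ≤
      |expMartingale W t x r ω| := fun ω => by
    have := expMartingale_pos (W := W) (t := t) hx r ω
    rw [abs_of_nonneg (sub_nonneg.2 (min_le_left _ _)), abs_of_pos this]
    linarith [le_min this.le hM.le]
  have hL : MemLp (fun ω => expMartingale W t x r ω - min (expMartingale W t x r ω) M) 2 P :=
    (memLp_expMartingale hWm hW ht htr).mono (hm.sub (hm.min measurable_const)).aestronglyMeasurable
      (ae_of_all _ hle)
  refine ⟨hL, ?_⟩
  have hval := integral_expMartingale_pow (x := x) hW ht htr 4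
  norm_num at hval
  rw [← hval, ← integral_div]
  refine integral_mono hL.integrable_sq ((integrable_expMartingale_pow hW ht htr 4).div_const _)
    fun ω => ?_
  have hp := expMartingale_pos (W := W) (t := t) hx r ω
  simp only
  set y := expMartingale W t x r ω
  -- The excess of `y` over `M` is at most `y² / M`, which brings in the fourth moment.
  rw [show y ^ 4 / M ^ 2 = (y ^ 2 / M) ^ 2 by ring]
  refine pow_le_pow_left₀ (sub_nonneg.2 (min_le_left _ _)) ?_ 2
  rcases le_total y M with h | h
  · rw [min_eq_left h, sub_self]; positivity
  · rw [min_eq_right h, le_div_iff₀ hM]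
    nlinarith

/-- Continuity in time and measurability in `ω` give joint measurability. Paths are continuous only
almost surely, so the process is first set to zero off a measurable event of full measure. -/
lemma aestronglyMeasurable_expMartingale (hWm : ∀ s, Measurable (W s)) (hW : IsBrownianReal W P)
    [IsProbabilityMeasure P] (μ : Measure ℝ) [SFinite μ] :
    AEStronglyMeasurable (fun p : ℝ × Ω => expMartingale W t x p.1 p.2) (μ.prod P) := by
  obtain ⟨A, hA, hAm, hAc⟩ := Filter.Eventually.exists_measurable_mem hW.cont
  have hsm : StronglyMeasurable (Function.uncurry
      fun r ω => A.indicator (expMartingale W t x r) ω) := by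
    refine stronglyMeasurable_uncurry_of_continuous_of_stronglyMeasurable (fun ω => ?_) fun r => ?_
    · by_cases h : ω ∈ A
      · simp only [h, indicator_of_mem, expMartingale]
        have := (hAc ω h).comp continuous_real_toNNReal
        simp only [Function.comp_def] at this
        fun_prop
      · simpa [h] using continuous_const
    · refine (Measurable.indicator ?_ hAm).stronglyMeasurable
      unfold expMartingale
      fun_prop
  refine hsm.aestronglyMeasurable.congr ?_
  have : ∀ᵐ p ∂(μ.prod P), p.2 ∈ A := Measure.quasiMeasurePreserving_snd.ae hA
  filter_upwards [this] with p hp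
  simp [Function.uncurry, hp]

end Exponential

end Liquidation

/-! ### Square-integral estimates and uniform grids -/

namespace Liquidation

section SquareIntegrals

variable {α : Type*} {mα : MeasurableSpace α} {μ : Measure α}

lemma lintegral_enorm_sq_eq_ofReal {f : α → ℝ} (hf : MemLp f 2 μ) :
    ∫⁻ x, ‖f x‖ₑ ^ 2 ∂μ = ENNReal.ofReal (∫ x, f x ^ 2 ∂μ) := by
  rw [ofReal_integral_eq_lintegral_ofReal hf.integrable_sq (ae_of_all _ fun x => sq_nonneg _)]
  refine lintegral_congr fun x => ?_
  rw [Real.enorm_eq_ofReal_abs, ← ENNReal.ofReal_pow (abs_nonneg _), sq_abs]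

lemma eLpNorm_two_le_of_lintegral_enorm_sq_le {f : α → ℝ} {K : ℝ≥0∞}
    (h : ∫⁻ x, ‖f x‖ₑ ^ 2 ∂μ ≤ K) : eLpNorm f 2 μ ≤ K ^ (2⁻¹ : ℝ) := by
  rw [eLpNorm_eq_lintegral_rpow_enorm_toReal (by norm_num) (by norm_num)]
  simp only [ENNReal.toReal_ofNat, one_div]
  refine ENNReal.rpow_le_rpow ?_ (by norm_num)
  exact_mod_cast h

lemma tendsto_eLpNorm_two_of_lintegral_enorm_sq_le {f : ℕ → α → ℝ} {K : ℝ}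
    (h : ∀ n, ∫⁻ x, ‖f n x‖ₑ ^ 2 ∂μ ≤ ENNReal.ofReal (K / (n + 1))) :
    Tendsto (fun n => eLpNorm (f n) 2 μ) atTop (𝓝 0) := by
  have h1 : Tendsto (fun n : ℕ => K / ((n : ℝ) + 1)) atTop (𝓝 0) :=
    tendsto_const_nhds.div_atTop (tendsto_atTop_add_const_right _ _ tendsto_natCast_atTop_atTop)
  have h2 := ((ENNReal.continuous_rpow_const (y := (2⁻¹ : ℝ))).tendsto _).comp
    (ENNReal.tendsto_ofReal h1)
  rw [ENNReal.ofReal_zero, ENNReal.zero_rpow_of_pos (by norm_num)] at h2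
  exact tendsto_of_tendsto_of_tendsto_of_le_of_le tendsto_const_nhds h2 (fun _ => zero_le)
    fun n => eLpNorm_two_le_of_lintegral_enorm_sq_le (h n)

lemma lintegral_enorm_sq_add_le {f g : α → ℝ} (hf : MemLp f 2 μ) (hg : MemLp g 2 μ) :
    ∫⁻ x, ‖f x + g x‖ₑ ^ 2 ∂μ ≤
      ENNReal.ofReal (2 * ∫ x, f x ^ 2 ∂μ + 2 * ∫ x, g x ^ 2 ∂μ) := by
  have hfg : MemLp (fun x => f x + g x) 2 μ := hf.add hg
  rw [lintegral_enorm_sq_eq_ofReal hfg]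
  refine ENNReal.ofReal_le_ofReal ?_
  rw [← integral_const_mul, ← integral_const_mul,
    ← integral_add (hf.integrable_sq.const_mul 2) (hg.integrable_sq.const_mul 2)]
  refine integral_mono hfg.integrable_sq
    ((hf.integrable_sq.const_mul 2).add (hg.integrable_sq.const_mul 2)) fun x => ?_
  simp only
  nlinarith [sq_nonneg (f x - g x)]

end SquareIntegrals

section Grid

/-- The points of the uniform grid with `n + 1` steps on `[t, r]`. -/
noncomputable def gridPoint (t r : ℝ) (n i : ℕ) : ℝ := t + i * ((r - t) / (n + 1))

variable {t r : ℝ} {n : ℕ}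

lemma gridPoint_zero : gridPoint t r n 0 = t := by simp [gridPoint]

lemma gridPoint_last : gridPoint t r n (n + 1) = r := by
  unfold gridPoint
  push_cast
  field_simp
  ring

lemma gridPoint_succ_sub (i : ℕ) :
    gridPoint t r n (i + 1) - gridPoint t r n i = (r - t) / (n + 1) := by
  unfold gridPoint
  push_cast
  ring

lemma monotone_gridPoint (htr : t ≤ r) : Monotone (gridPoint t r n) := by
  refine monotone_nat_of_le_succ fun i => sub_nonneg.1 ?_
  rw [gridPoint_succ_sub]
  exact div_nonneg (sub_nonneg.2 htr) (by positivity)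

lemma le_gridPoint (htr : t ≤ r) (i : ℕ) : t ≤ gridPoint t r n i := by
  have h := monotone_gridPoint (n := n) htr i.zero_le
  rwa [gridPoint_zero] at h

lemma gridPoint_le (htr : t ≤ r) {i : ℕ} (hi : i ≤ n + 1) : gridPoint t r n i ≤ r := by
  have h := monotone_gridPoint (n := n) htr hi
  rwa [gridPoint_last] at h

end Grid

/-! ### The exponential martingale as an Itô integral of itself -/

section ExponentialSolution

variable {Ω : Type*} {mΩ : MeasurableSpace Ω} {P : Measure Ω} {W : ℝ≥0 → Ω → ℝ}
  {hWm : ∀ s, Measurable (W s)} {t r x : ℝ}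

/-- The exponential martingale, sampled on the uniform grid and truncated. -/
noncomputable def gridProcess (P : Measure Ω) (hWm : ∀ s, Measurable (W s)) (hx : 0 < x)
    (htr : t ≤ r) (n : ℕ) : SimpleProcess (brownianFiltration P W hWm) t r where
  n := n + 1
  left i := gridPoint t r n i
  right i := gridPoint t r n (i + 1)
  coef i ω := min (expMartingale W t x (gridPoint t r n i) ω) (n + 1)
  le_left i := le_gridPoint htr i
  left_le_right i := monotone_gridPoint htr (i : ℕ).le_succ
  right_le i := gridPoint_le htr i.2
  measurable_coef i := (measurable_expMartingale (le_gridPoint htr i)).min measurable_const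
  bounded_coef i := ⟨n + 1, fun ω => by
    rw [abs_of_nonneg (le_min (expMartingale_pos hx _ ω).le (by positivity))]
    exact min_le_right _ _⟩

lemma exists_gridProcess_value_eq (hx : 0 < x) (htr : t ≤ r) (n : ℕ) {s : ℝ} (hs : s ∈ Ioc t r) :
    ∃ i < n + 1, s ∈ Ioc (gridPoint t r n i) (gridPoint t r n (i + 1)) ∧ ∀ ω,
      (gridProcess P hWm hx htr n).value s ω =
        min (expMartingale W t x (gridPoint t r n i) ω) (n + 1) := by
  have hmono := monotone_gridPoint (n := n) htr
  have hu := hmono.biUnion_Ico_Ioc_map_succ 0 (n + 1)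
  rw [gridPoint_zero, gridPoint_last] at hu
  rw [← hu] at hs
  simp only [mem_iUnion] at hs
  obtain ⟨i, hi, his⟩ := hs
  refine ⟨i, hi.2, his, fun ω => ?_⟩
  refine (Finset.sum_eq_single (⟨i, hi.2⟩ : Fin (n + 1)) (fun j _ hj => ?_)
    (fun h => absurd (Finset.mem_univ _) h)).trans ?_
  · refine indicator_of_notMem (fun hjs => ?_) _
    have hij : (j : ℕ) ≠ i := fun h => hj (Fin.ext h)
    exact Set.disjoint_left.1 (hmono.pairwise_disjoint_on_Ioc_succ hij) hjs his
  · exact indicator_of_mem his _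

lemma exp_sub_one_le_mul_exp (h : ℝ) : Real.exp h - 1 ≤ h * Real.exp h := by
  have h1 := Real.add_one_le_exp (-h)
  have h2 : Real.exp (-h) * Real.exp h = 1 := by rw [← Real.exp_add]; simp
  nlinarith [Real.exp_pos h]

lemma exp_sub_one_sub_le {h : ℝ} (h0 : 0 ≤ h) : Real.exp h - 1 - h ≤ h ^ 2 * Real.exp h := by
  nlinarith [exp_sub_one_le_mul_exp h]

variable [IsProbabilityMeasure P]

/-- The error is the oscillation within one cell plus the excess over the truncation level `n + 1`.
Their mean squares are of order `1 / (n + 1)` and `1 / (n + 1)²`. Truncation is forced by the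
boundedness of the coefficients of a simple process. -/
lemma lintegral_expMartingale_sub_gridProcess_value_le (hW : IsPreBrownianReal W P) (ht : 0 ≤ t)
    (hx : 0 < x) (htr : t ≤ r) (n : ℕ) {s : ℝ} (hs : s ∈ Ioc t r) :
    ∫⁻ ω, ‖expMartingale W t x s ω - (gridProcess P hWm hx htr n).value s ω‖ₑ ^ 2 ∂P ≤
      ENNReal.ofReal ((2 * (x ^ 2 * Real.exp (2 * (r - t)) * (r - t)) +
        2 * (x ^ 4 * Real.exp (6 * (r - t)))) / (n + 1)) := by
  obtain ⟨i, hi, his, hv⟩ := exists_gridProcess_value_eq (P := P) (hWm := hWm) hx htr n hs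
  have hti := le_gridPoint (n := n) htr i
  have hn : (0 : ℝ) < n + 1 := by positivity
  have hL := sub_nonneg.2 htr
  obtain ⟨hm, hexc⟩ := integral_expMartingale_excess_sq_le hWm hW hx ht hti hn
  have hd : MemLp (fun ω => expMartingale W t x s ω - expMartingale W t x (gridPoint t r n i) ω)
      2 P := (memLp_expMartingale hWm hW ht hs.1.le).sub (memLp_expMartingale hWm hW ht hti)
  have e : ∀ ω, expMartingale W t x s ω - (gridProcess P hWm hx htr n).value s ω =
      (expMartingale W t x s ω - expMartingale W t x (gridPoint t r n i) ω) +
        (expMartingale W t x (gridPoint t r n i) ω -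
          min (expMartingale W t x (gridPoint t r n i) ω) (n + 1)) := fun ω => by rw [hv]; ring
  simp_rw [e]
  refine (lintegral_enorm_sq_add_le hd hm).trans (ENNReal.ofReal_le_ofReal ?_)
  rw [integral_expMartingale_sub_sq hWm hW ht hti his.1.le, add_div, mul_div_assoc 2, mul_div_assoc 2]
  refine add_le_add (mul_le_mul_of_nonneg_left ?_ zero_le_two)
    (mul_le_mul_of_nonneg_left (hexc.trans ?_) zero_le_two)
  · have hstep : s - gridPoint t r n i ≤ (r - t) / (n + 1) := by
      rw [← gridPoint_succ_sub (t := t) (r := r) (n := n) i]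
      linarith [his.2]
    have h1 : Real.exp (s - gridPoint t r n i) - 1 ≤
        (r - t) / (n + 1) * Real.exp (s - gridPoint t r n i) :=
      (exp_sub_one_le_mul_exp _).trans (mul_le_mul_of_nonneg_right hstep (Real.exp_pos _).le)
    calc x ^ 2 * Real.exp (gridPoint t r n i - t) * (Real.exp (s - gridPoint t r n i) - 1)
        ≤ x ^ 2 * Real.exp (gridPoint t r n i - t) *
          ((r - t) / (n + 1) * Real.exp (s - gridPoint t r n i)) := by gcongr
      _ = x ^ 2 * Real.exp (s - t) * (r - t) / (n + 1) := by
        rw [show s - t = (gridPoint t r n i - t) + (s - gridPoint t r n i) by ring, Real.exp_add]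
        ring
      _ ≤ _ := by
        gcongr
        linarith [hs.2]
  · have h1 : gridPoint t r n i ≤ r := gridPoint_le htr hi.le
    gcongr
    nlinarith

lemma lintegral_prod_expMartingale_sub_gridProcess_value_le (hW : IsPreBrownianReal W P)
    (ht : 0 ≤ t) (hx : 0 < x) (htr : t ≤ r) (n : ℕ) :
    ∫⁻ p : ℝ × Ω, ‖expMartingale W t x p.1 p.2 - (gridProcess P hWm hx htr n).value p.1 p.2‖ₑ ^ 2
      ∂((volume.restrict (Icc t r)).prod P) ≤
      ENNReal.ofReal ((2 * (x ^ 2 * Real.exp (2 * (r - t)) * (r - t)) +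
        2 * (x ^ 4 * Real.exp (6 * (r - t)))) * (r - t) / (n + 1)) := by
  have hL := sub_nonneg.2 htr
  refine (lintegral_prod_le _).trans ?_
  -- The left endpoint lies in no half-open cell, so the pointwise estimate is not available there;
  -- it is a null set.
  rw [← restrict_Ioc_eq_restrict_Icc]
  refine (setLIntegral_mono' measurableSet_Ioc fun s hs =>
    lintegral_expMartingale_sub_gridProcess_value_le hW ht hx htr n hs).trans ?_
  rw [setLIntegral_const, Real.volume_Ioc, ← ENNReal.ofReal_mul (by positivity)]
  exact (congrArg _ (by ring)).le

lemma memLp_prod_expMartingale (hWm : ∀ s, Measurable (W s)) (hW : IsBrownianReal W P)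
    (ht : 0 ≤ t) : MemLp (fun p : ℝ × Ω => expMartingale W t x p.1 p.2) 2
      ((volume.restrict (Icc t r)).prod P) := by
  refine ⟨aestronglyMeasurable_expMartingale hWm hW _, ?_⟩
  refine (eLpNorm_two_le_of_lintegral_enorm_sq_le (K := ENNReal.ofReal
    (x ^ 2 * Real.exp (r - t)) * ENNReal.ofReal (r - t)) ?_).trans_lt
    (ENNReal.rpow_lt_top_of_nonneg (by norm_num) (ENNReal.mul_ne_top ENNReal.ofReal_ne_top
      ENNReal.ofReal_ne_top))
  refine (lintegral_prod_le _).trans ?_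
  rw [← Real.volume_Icc, ← setLIntegral_const]
  refine setLIntegral_mono' measurableSet_Icc fun s hs => ?_
  rw [lintegral_enorm_sq_eq_ofReal
    (memLp_expMartingale hWm hW.toIsPreBrownianReal ht hs.1),
    integral_expMartingale_pow hW.toIsPreBrownianReal ht hs.1]
  refine ENNReal.ofReal_le_ofReal ?_
  norm_num
  gcongr
  exact hs.2

/-- After telescoping, each step is `X_i (exp (D - h / 2) - 1)`, against `min X_i (n + 1) * D` in
the simple integral. What remains is a sum of two martingale transforms: `X_i` times the expansion
remainder, and the truncation excess times `D`. Orthogonality makes each second moment a sum over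
the cells. -/
lemma lintegral_expMartingale_sub_gridProcess_integral_le (hW : IsPreBrownianReal W P) (ht : 0 ≤ t)
    (hx : 0 < x) (htr : t ≤ r) (n : ℕ) :
    ∫⁻ ω, ‖expMartingale W t x r ω - x - (gridProcess P hWm hx htr n).integral W ω‖ₑ ^ 2 ∂P ≤
      ENNReal.ofReal ((2 * (x ^ 2 * Real.exp (2 * (r - t)) * (r - t) ^ 2) +
        2 * (x ^ 4 * Real.exp (6 * (r - t)) * (r - t))) / (n + 1)) := by
  have hn : (0 : ℝ) < n + 1 := by positivity
  have hL := sub_nonneg.2 htr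
  have hmono := monotone_gridPoint (n := n) htr
  have htau := fun i => le_gridPoint (n := n) htr i
  set τ := gridPoint t r n with hτ
  set h := (r - t) / (n + 1) with hh
  have hh0 : 0 ≤ h := div_nonneg hL hn.le
  have hhL : h ≤ r - t := div_le_self hL (by linarith [n.cast_nonneg (α := ℝ)])
  have hlaw : ∀ i, HasLaw (fun ω => W (τ (i + 1)).toNNReal ω - W (τ i).toNNReal ω)
      (gaussianReal 0 h.toNNReal) P := fun i => by
    have := hasLaw_increment hW (ht.trans (htau i)) (hmono i.le_succ)
    rwa [show τ i.succ - τ i = h from gridPoint_succ_sub i] at this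
  obtain ⟨-, hA, hA2⟩ := integral_sq_sum_mul_comp_increment hW hmono
    (η := fun i => expMartingale W t x (τ i)) (ψ := fun _ => expRemainder h)
    (fun i => measurable_expMartingale (hWm := hWm) (htau i))
    (fun i => memLp_expMartingale hWm hW ht (htau i)) (fun _ => measurable_expRemainder h)
    (fun i => memLp_expRemainder (hlaw i)) (fun i => integral_expRemainder hh0 (hlaw i)) (n + 1)
  obtain ⟨-, hB, hB2⟩ := integral_sq_sum_mul_comp_increment hW hmono
    (η := fun i ω => expMartingale W t x (τ i) ω - min (expMartingale W t x (τ i) ω) (n + 1))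
    (ψ := fun _ => id)
    (fun i => (measurable_expMartingale (hWm := hWm) (htau i)).sub
      ((measurable_expMartingale (hWm := hWm) (htau i)).min measurable_const))
    (fun i => (integral_expMartingale_excess_sq_le hWm hW hx ht (htau i) hn).1)
    (fun _ => measurable_id) (fun i => (hlaw i).hasGaussianLaw.memLp_two)
    (fun i => integral_increment hW (ht.trans (htau i)) (hmono i.le_succ)) (n + 1)
  have e : ∀ ω, expMartingale W t x r ω - x - (gridProcess P hWm hx htr n).integral W ω =
      (∑ i ∈ Finset.range (n + 1), expMartingale W t x (τ i) ω *
        expRemainder h (W (τ (i + 1)).toNNReal ω - W (τ i).toNNReal ω)) +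
      ∑ i ∈ Finset.range (n + 1), (expMartingale W t x (τ i) ω -
        min (expMartingale W t x (τ i) ω) (n + 1)) *
        id (W (τ (i + 1)).toNNReal ω - W (τ i).toNNReal ω) := fun ω => by
    have h1 : expMartingale W t x r ω - x = ∑ i ∈ Finset.range (n + 1),
        (expMartingale W t x (τ (i + 1)) ω - expMartingale W t x (τ i) ω) := by
      rw [Finset.sum_range_sub (fun i => expMartingale W t x (τ i) ω), hτ, gridPoint_last,
        gridPoint_zero, expMartingale_self]
    have h2 : (gridProcess P hWm hx htr n).integral W ω = ∑ i ∈ Finset.range (n + 1),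
        min (expMartingale W t x (τ i) ω) (n + 1) *
          (W (τ (i + 1)).toNNReal ω - W (τ i).toNNReal ω) :=
      (Finset.sum_range fun i => min (expMartingale W t x (τ i) ω) (n + 1) *
          (W (τ (i + 1)).toNNReal ω - W (τ i).toNNReal ω)).symm
    rw [h1, h2, ← Finset.sum_sub_distrib, ← Finset.sum_add_distrib]
    refine Finset.sum_congr rfl fun i _ => ?_
    rw [expMartingale_eq_mul (τ i) (τ (i + 1)), show τ (i + 1) - τ i = h from gridPoint_succ_sub i,
      expRemainder, id]
    ring
  simp_rw [e]
  refine (lintegral_enorm_sq_add_le hA hB).trans (ENNReal.ofReal_le_ofReal ?_)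
  rw [hA2, hB2, add_div, mul_div_assoc 2, mul_div_assoc 2]
  refine add_le_add (mul_le_mul_of_nonneg_left ?_ zero_le_two)
    (mul_le_mul_of_nonneg_left ?_ zero_le_two)
  · refine (Finset.sum_le_card_nsmul (Finset.range (n + 1)) _
      (x ^ 2 * Real.exp (2 * (r - t)) * h ^ 2) fun i hi => ?_).trans (le_of_eq ?_)
    · rw [integral_expMartingale_pow hW ht (htau i), integral_expRemainder_sq hh0 (hlaw i)]
      have h1 : τ (i + 1) ≤ r := gridPoint_le htr (Finset.mem_range.1 hi)
      have h2 : τ (i + 1) - τ i = h := gridPoint_succ_sub i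
      calc x ^ 2 * Real.exp (((2 : ℕ) ^ 2 - (2 : ℕ)) / 2 * (τ i - t)) * (Real.exp h - 1 - h)
          ≤ x ^ 2 * Real.exp (((2 : ℕ) ^ 2 - (2 : ℕ)) / 2 * (τ i - t)) *
            (h ^ 2 * Real.exp h) := by
            gcongr
            exact exp_sub_one_sub_le hh0
        _ = x ^ 2 * Real.exp (τ i - t + h) * h ^ 2 := by
            norm_num
            rw [Real.exp_add]
            ring
        _ ≤ _ := by
            gcongr
            linarith
    · rw [Finset.card_range, nsmul_eq_mul, hh]
      push_cast
      field_simp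
  · refine (Finset.sum_le_card_nsmul (Finset.range (n + 1)) _
      (x ^ 4 * Real.exp (6 * (r - t)) / (n + 1) ^ 2 * h) fun i hi => ?_).trans ?_
    · have h1 := (integral_expMartingale_excess_sq_le hWm hW hx ht (htau i) hn).2
      have h2 := integral_sq_of_hasLaw (hlaw i)
      rw [Real.coe_toNNReal _ hh0] at h2
      simp only [id]
      rw [h2]
      refine mul_le_mul_of_nonneg_right (h1.trans ?_) hh0
      have h3 : τ i ≤ r := gridPoint_le htr (Finset.mem_range.1 hi).le
      gcongr
    · rw [Finset.card_range, nsmul_eq_mul, hh]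
      push_cast
      have h3 : (n + 1 : ℝ) * (x ^ 4 * Real.exp (6 * (r - t)) / (n + 1) ^ 2 * ((r - t) / (n + 1)))
          = x ^ 4 * Real.exp (6 * (r - t)) * (r - t) / (n + 1) ^ 2 := by
        field_simp
      rw [h3]
      gcongr
      nlinarith

/-- The exponential martingale is the Itô integral of itself. -/
lemma isItoIntegral_expMartingale (hWm : ∀ s, Measurable (W s)) (hW : IsBrownianReal W P)
    (ht : 0 ≤ t) (hx : 0 < x) (htr : t ≤ r) :
    IsItoIntegral P W hWm t r (expMartingale W t x) (fun ω => expMartingale W t x r ω - x) :=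
  ⟨memLp_prod_expMartingale hWm hW ht,
    (memLp_expMartingale hWm hW.toIsPreBrownianReal ht htr).sub (memLp_const x),
    gridProcess P hWm hx htr,
    tendsto_eLpNorm_two_of_lintegral_enorm_sq_le fun n =>
      lintegral_prod_expMartingale_sub_gridProcess_value_le hW.toIsPreBrownianReal ht hx htr n,
    tendsto_eLpNorm_two_of_lintegral_enorm_sq_le fun n =>
      lintegral_expMartingale_sub_gridProcess_integral_le hW.toIsPreBrownianReal ht hx htr n⟩

/-- The exponential martingale solves `dX = X dW`. -/
lemma isSDESolution_expMartingale (hWm : ∀ s, Measurable (W s)) (hW : IsBrownianReal W P)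
    (ht : 0 ≤ t) (hx : 0 < x) (T : ℝ) :
    IsSDESolution P W hWm exDrift exVol t T x (expMartingale W t x) where
  adapted r hr := measurable_expMartingale hr.1
  continuous := by
    filter_upwards [hW.cont] with ω hω
    have := hω.comp continuous_real_toNNReal
    simp only [Function.comp_def] at this
    refine Continuous.continuousOn ?_
    unfold expMartingale
    fun_prop
  initial := ae_of_all _ expMartingale_self
  drift_integrable := ae_of_all _ fun ω => by simp [exDrift]
  equation r hr := by simpa [exDrift, exVol] using isItoIntegral_expMartingale hWm hW ht hx hr.1

end ExponentialSolution

end Liquidation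

/-! ### Uniqueness, positivity and mean of the price -/

namespace Liquidation

section Uniqueness

variable {Ω : Type*} {mΩ : MeasurableSpace Ω} {P : Measure Ω} {W : ℝ≥0 → Ω → ℝ}
  {hWm : ∀ s, Measurable (W s)}

lemma integral_sq_eq_of_eLpNorm_eq {α β : Type*} {mα : MeasurableSpace α}
    {mβ : MeasurableSpace β} {μ : Measure α} {ν : Measure β} {f : α → ℝ} {g : β → ℝ}
    (hf : MemLp f 2 μ) (hg : MemLp g 2 ν) (h : eLpNorm f 2 μ = eLpNorm g 2 ν) :
    ∫ x, f x ^ 2 ∂μ = ∫ y, g y ^ 2 ∂ν := by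
  rw [eLpNorm_eq_lintegral_rpow_enorm_toReal (by norm_num) (by norm_num),
    eLpNorm_eq_lintegral_rpow_enorm_toReal (by norm_num) (by norm_num)] at h
  have h1 := ENNReal.rpow_left_injective (x := 1 / (2 : ℝ≥0∞).toReal) (by simp) h
  simp only [ENNReal.toReal_ofNat, ENNReal.rpow_ofNat] at h1
  rw [lintegral_enorm_sq_eq_ofReal hf, lintegral_enorm_sq_eq_ofReal hg] at h1
  exact (ENNReal.ofReal_eq_ofReal_iff (integral_nonneg fun _ => sq_nonneg _)
    (integral_nonneg fun _ => sq_nonneg _)).1 h1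

/-- The Itô isometry, as an equality of iterated integrals. -/
lemma IsItoIntegral.integral_sq_eq [IsProbabilityMeasure P] (hW : IsPreBrownianReal W P)
    {a b : ℝ} {H : ℝ → Ω → ℝ} {I : Ω → ℝ} (ha : 0 ≤ a) (hab : a ≤ b)
    (h : IsItoIntegral P W hWm a b H I) :
    ∫ ω, I ω ^ 2 ∂P = ∫ s in a..b, ∫ ω, H s ω ^ 2 ∂P := by
  rw [integral_sq_eq_of_eLpNorm_eq h.2.1 h.1 (h.eLpNorm_eq hW ha),
    integral_prod _ h.1.integrable_sq, integral_Icc_eq_integral_Ioc,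
    intervalIntegral.integral_of_le hab]

/-- A nonnegative function which is its own primitive vanishes. -/
lemma eq_zero_of_eq_integral_self {φ : ℝ → ℝ} {t T : ℝ} (hφ : ∀ r, 0 ≤ φ r)
    (hi : IntegrableOn φ (Icc t T)) (h : ∀ r ∈ Icc t T, φ r = ∫ s in t..r, φ s) :
    ∀ r ∈ Icc t T, φ r = 0 := by
  have hint : ∀ r ∈ Icc t T, IntervalIntegrable φ volume t r := fun r hr =>
    (intervalIntegrable_iff_integrableOn_Icc_of_le hr.1).2
      (hi.mono_set (Icc_subset_Icc_right hr.2))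
  set M := ∫ s in Icc t T, φ s with hM
  -- Iterating the equation gains a factorial at each round; this needs integrability of `φ` only.
  have hb : ∀ n : ℕ, ∀ r ∈ Icc t T, φ r ≤ M * ((r - t) ^ n / n.factorial) := by
    intro n
    induction n with
    | zero =>
      intro r hr
      rw [h r hr, intervalIntegral.integral_of_le hr.1, ← integral_Icc_eq_integral_Ioc]
      simpa using setIntegral_mono_set hi (ae_of_all _ hφ)
        (Icc_subset_Icc_right hr.2).eventuallyLE
    | succ n ih =>
      intro r hr
      have hc : Continuous fun s : ℝ => M * ((s - t) ^ n / n.factorial) := by fun_prop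
      calc φ r = ∫ s in t..r, φ s := h r hr
        _ ≤ ∫ s in t..r, M * ((s - t) ^ n / n.factorial) :=
          intervalIntegral.integral_mono_on hr.1 (hint r hr) (hc.intervalIntegrable _ _)
            fun s hs => ih s ⟨hs.1, hs.2.trans hr.2⟩
        _ = M * ((r - t) ^ (n + 1) / (n + 1).factorial) := by
          rw [intervalIntegral.integral_const_mul, intervalIntegral.integral_div,
            intervalIntegral.integral_comp_sub_right (fun s => s ^ n), integral_pow,
            Nat.factorial_succ]
          push_cast
          simp only [sub_self, ne_eq, Nat.add_eq_zero_iff, one_ne_zero, and_false,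
            not_false_eq_true, zero_pow, sub_zero]
          rw [div_div]
  intro r hr
  refine le_antisymm ?_ (hφ r)
  have hlim := (FloorSemiring.tendsto_pow_div_factorial_atTop (r - t)).const_mul M
  rw [mul_zero] at hlim
  exact ge_of_tendsto' hlim fun n => hb n r hr

variable {t T x : ℝ} {X : ℝ → Ω → ℝ}

lemma IsSDESolution.isItoIntegral
    (h : IsSDESolution P W hWm exDrift exVol t T x X) {r : ℝ} (hr : r ∈ Icc t T) :
    IsItoIntegral P W hWm t r X (fun ω => X r ω - x) := by
  simpa [exDrift, exVol] using h.equation r hr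

variable [IsProbabilityMeasure P]

/-- The price is the exponential martingale. -/
lemma IsSDESolution.ae_eq_expMartingale (hW : IsBrownianReal W P) (ht : 0 ≤ t) (hx : 0 < x)
    (h : IsSDESolution P W hWm exDrift exVol t T x X) {r : ℝ} (hr : r ∈ Icc t T) :
    X r =ᵐ[P] expMartingale W t x r := by
  have hsub : ∀ s ∈ Icc t T, IsItoIntegral P W hWm t s
      (fun u ω => X u ω - expMartingale W t x u ω) (fun ω => X s ω - expMartingale W t x s ω) := by
    intro s hs
    simpa using (h.isItoIntegral hs).sub hW.toIsPreBrownianReal ht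
      (isItoIntegral_expMartingale hWm hW ht hx hs.1)
  -- The difference of the two solutions is the Itô integral of itself, so by the isometry its
  -- second moment is its own primitive.
  have hφ : ∀ s ∈ Icc t T, ∫ ω, (X s ω - expMartingale W t x s ω) ^ 2 ∂P =
      ∫ u in t..s, ∫ ω, (X u ω - expMartingale W t x u ω) ^ 2 ∂P := by
    intro s hs
    exact (hsub s hs).integral_sq_eq hW.toIsPreBrownianReal ht hs.1
  have hint : IntegrableOn (fun u => ∫ ω, (X u ω - expMartingale W t x u ω) ^ 2 ∂P) (Icc t T) :=
    (hsub T (right_mem_Icc.2 (hr.1.trans hr.2))).1.integrable_sq.integral_prod_left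
  have h0 := eq_zero_of_eq_integral_self (fun s => integral_nonneg fun ω => sq_nonneg _)
    hint hφ r hr
  rw [integral_eq_zero_iff_of_nonneg (fun ω => sq_nonneg _) (hsub r hr).2.1.integrable_sq] at h0
  filter_upwards [h0] with ω hω
  exact sub_eq_zero.1 (pow_eq_zero_iff two_ne_zero |>.1 hω)

lemma IsSDESolution.ae_pos (hW : IsBrownianReal W P) (ht : 0 ≤ t) (hx : 0 < x)
    (h : IsSDESolution P W hWm exDrift exVol t T x X) {r : ℝ} (hr : r ∈ Icc t T) :
    ∀ᵐ ω ∂P, 0 < X r ω := by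
  filter_upwards [h.ae_eq_expMartingale hW ht hx hr] with ω hω
  rw [hω]
  exact expMartingale_pos hx r ω

lemma IsSDESolution.integral_eq (hW : IsPreBrownianReal W P) (ht : 0 ≤ t)
    (h : IsSDESolution P W hWm exDrift exVol t T x X) {r : ℝ} (hr : r ∈ Icc t T) :
    ∫ ω, X r ω ∂P = x := by
  have h1 := h.isItoIntegral hr
  have h2 := h1.integral_eq_zero hW ht
  have hX : Integrable (X r) P := by
    refine ((h1.2.1.integrable one_le_two).add (integrable_const x)).congr (ae_of_all _ fun ω => ?_)
    simp
  rw [integral_sub hX (integrable_const x)] at h2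
  simpa [sub_eq_zero] using h2

lemma IsSDESolution.integrable_prod (h : IsSDESolution P W hWm exDrift exVol t T x X)
    {a : ℝ} (hta : t ≤ a) (haT : a ≤ T) :
    Integrable (fun p : ℝ × Ω => X p.1 p.2) ((volume.restrict (Ioc a T)).prod P) := by
  have h1 := (h.isItoIntegral (right_mem_Icc.2 (hta.trans haT))).1.integrable one_le_two
  have h2 := h1.restrict (s := Ioc a T ×ˢ univ)
  rw [← Measure.prod_restrict, Measure.restrict_restrict measurableSet_Ioc, Measure.restrict_univ,
    inter_eq_self_of_subset_left] at h2
  · exact h2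
  · exact fun s hs => ⟨hta.trans hs.1.le, hs.2⟩

/-- Fubini reduces this to the constancy of the mean of the price. -/
lemma IsSDESolution.integral_integral_eq (hW : IsPreBrownianReal W P) (ht : 0 ≤ t)
    (h : IsSDESolution P W hWm exDrift exVol t T x X) {a : ℝ} (hta : t ≤ a) (haT : a ≤ T) :
    (∀ᵐ ω ∂P, IntervalIntegrable (fun r => X r ω) volume a T) ∧
      Integrable (fun ω => ∫ r in a..T, X r ω) P ∧
      ∫ ω, (∫ r in a..T, X r ω) ∂P = x * (T - a) := by
  have hi := h.integrable_prod hta haT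
  simp_rw [intervalIntegral.integral_of_le haT, intervalIntegrable_iff_integrableOn_Ioc_of_le haT]
  refine ⟨hi.prod_left_ae, hi.integral_prod_right, ?_⟩
  rw [← integral_integral_swap hi, setIntegral_congr_fun (g := fun _ => x) measurableSet_Ioc
    fun r hr => h.integral_eq hW ht ⟨hta.trans hr.1.le, hr.2⟩, setIntegral_const]
  simp [haT, mul_comm]

end Uniqueness

end Liquidation

/-! ### Liquidation times of constant controls and of their variations -/

namespace Liquidation

section LiquidationTimes

variable {T t q k cbar θ : ℝ}

/-- Only interior values are prescribed, since the variation may jump at the ends of its pieces. -/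
lemma integral_eq_of_forall_Ioo {f : ℝ → ℝ} {a b m : ℝ} (hab : a ≤ b)
    (h : ∀ s ∈ Ioo a b, f s = m) :
    IntervalIntegrable f volume a b ∧ ∫ s in a..b, f s = m * (b - a) := by
  constructor
  · rw [intervalIntegrable_iff_integrableOn_Ioo_of_le hab, integrableOn_congr_fun h
      measurableSet_Ioo]
    exact integrableOn_const (by simp)
  · rw [intervalIntegral.integral_of_le hab, integral_Ioc_eq_integral_Ioo,
      setIntegral_congr_fun measurableSet_Ioo h, setIntegral_const]
    simp [hab, mul_comm]

lemma liqTime_eq_of_forall_ne {c : ℝ → ℝ} (h : ∀ r, t ≤ r → r < T → rawInventory t q c r ≠ 0) :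
    liqTime T t q c = T := by
  refine IsLeast.csInf_eq ⟨mem_insert _ _, ?_⟩
  rintro r (rfl | ⟨h1, h2⟩)
  · exact le_rfl
  · exact not_lt.1 fun hr => h r h1 hr h2

lemma liqTime_eq_of_first_zero {c : ℝ → ℝ} {r₀ : ℝ} (ht : t ≤ r₀) (hT : r₀ ≤ T)
    (h0 : rawInventory t q c r₀ = 0) (h : ∀ r, t ≤ r → r < r₀ → rawInventory t q c r ≠ 0) :
    liqTime T t q c = r₀ := by
  refine IsLeast.csInf_eq ⟨mem_insert_of_mem _ ⟨ht, h0⟩, ?_⟩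
  rintro r (rfl | ⟨h1, h2⟩)
  · exact hT
  · exact not_lt.1 fun hr => h r h1 hr h2

lemma rawInventory_const (r : ℝ) : rawInventory t q (fun _ => k) r = q - k * (r - t) := by
  simp [rawInventory, mul_comm]

lemma liqTime_const (hq : 0 < q) (hk : 0 ≤ k) (h : k * (T - t) ≤ q) :
    liqTime T t q (fun _ => k) = T := by
  refine liqTime_eq_of_forall_ne fun r _ hr => ne_of_gt ?_
  rw [rawInventory_const]
  -- For `k = 0` the inventory stays positive because `q > 0`; for `k > 0` strictness comes from `r
  -- < T`.
  rcases hk.eq_or_lt with rfl | hk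
  · linarith
  · nlinarith

/-- As `τ = T`, the correction `γ / θ` is supported on `[T, ∞)` and does not affect the integral up
to `r ≤ T`; only the rates `c̄` and `k` enter. -/
lemma rawInventory_variation (hτ : liqTime T t q (fun _ => k) = T) (hθ : 0 < θ)
    {r : ℝ} (htr : t ≤ r) (hrT : r ≤ T) :
    rawInventory t q (variation T t q (fun _ => k) cbar θ) r =
      q - (cbar * min (r - t) θ + k * max (r - t - θ) 0) := by
  have h1 : ∀ s ∈ Ioo t (min r (t + θ)), variation T t q (fun _ => k) cbar θ s = cbar := by
    intro s hs
    have hs2 := lt_min_iff.1 hs.2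
    unfold variation
    rw [hτ, indicator_of_notMem (fun h => absurd h.2 (not_lt.2 hs.1.le)),
      indicator_of_mem (mem_Ico.2 ⟨hs.1.le, lt_min hs2.2 (hs2.1.trans_le hrT)⟩),
      indicator_of_notMem (fun h => absurd hs2.2 (not_lt.2 h.1)),
      indicator_of_notMem (fun h => absurd (hs2.1.trans_le hrT) (not_lt.2 (mem_Ici.1 h)))]
    ring
  have h2 : ∀ s ∈ Ioo (t + θ) r, variation T t q (fun _ => k) cbar θ s = k := by
    intro s hs
    unfold variation
    rw [hτ, indicator_of_notMem (fun h => absurd h.2 (not_lt.2 (by linarith [hs.1]))),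
      indicator_of_notMem (fun h => absurd (lt_min_iff.1 h.2).1 (not_lt.2 hs.1.le)),
      indicator_of_mem (mem_Ico.2 ⟨hs.1.le, hs.2.trans_le hrT⟩),
      indicator_of_notMem (fun h => absurd (hs.2.trans_le hrT) (not_lt.2 (mem_Ici.1 h)))]
    ring
  unfold rawInventory
  rcases le_total r (t + θ) with h | h
  · rw [min_eq_left h] at h1
    rw [(integral_eq_of_forall_Ioo htr h1).2, min_eq_left (by linarith), max_eq_right (by linarith)]
    ring
  · rw [min_eq_right h] at h1
    have i1 := integral_eq_of_forall_Ioo (by linarith) h1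
    have i2 := integral_eq_of_forall_Ioo h h2
    rw [← intervalIntegral.integral_add_adjacent_intervals i1.1 i2.1, i1.2, i2.2,
      min_eq_right (by linarith), max_eq_left (by linarith)]
    ring

/-- The variation never sells more than the constant control, whose inventory is positive before
`T`. -/
lemma liqTimeVar_of_le (hq : 0 < q) (hk : 0 ≤ k) (h : k * (T - t) ≤ q)
    (hck : cbar ≤ k) (hθ : 0 < θ) :
    liqTimeVar T t q (fun _ => k) cbar θ = T := by
  refine liqTime_eq_of_forall_ne fun r htr hr => ne_of_gt ?_
  rw [rawInventory_variation (liqTime_const hq hk h) hθ htr hr.le, sub_pos]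
  have h1 : cbar * min (r - t) θ ≤ k * min (r - t) θ :=
    mul_le_mul_of_nonneg_right hck (le_min (sub_nonneg.2 htr) hθ.le)
  have h2 : k * min (r - t) θ + k * max (r - t - θ) 0 = k * (r - t) := by
    rcases le_total (r - t) θ with h | h
    · rw [min_eq_left h, max_eq_right (by linarith)]; ring
    · rw [min_eq_right h, max_eq_left (by linarith)]; ring
  have h3 : k * (r - t) < q := by
    rcases hk.eq_or_lt with rfl | hk
    · linarith
    · nlinarith
  linarith

/-- The surplus `(c̄ - k) θ` sold early saves the time that rate `k` would need for it. The bound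
`c̄ θ < q` prevents depletion while the rate `c̄` is still in use. -/
lemma liqTimeVar_of_lt (htT : t < T) (hk : 0 < k) (h : k * (T - t) = q)
    (hck : k < cbar) (hθ : 0 < θ) (hθq : cbar * θ < q) :
    t + θ ≤ T - (cbar - k) * θ / k ∧ T - (cbar - k) * θ / k < T ∧
      liqTimeVar T t q (fun _ => k) cbar θ = T - (cbar - k) * θ / k := by
  set r₀ := T - (cbar - k) * θ / k with hr₀
  have hkr : k * r₀ = k * T - (cbar - k) * θ := by rw [hr₀]; field_simp
  have hq : 0 < q := by rw [← h]; exact mul_pos hk (sub_pos.2 htT)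
  have h1 : t + θ ≤ r₀ := by
    by_contra! hlt
    nlinarith
  have h2 : r₀ < T := sub_lt_self _ (div_pos (mul_pos (sub_pos.2 hck) hθ) hk)
  refine ⟨h1, h2, ?_⟩
  have hraw := fun {r : ℝ} (htr : t ≤ r) (hrT : r ≤ T) =>
    rawInventory_variation (cbar := cbar) (liqTime_const hq hk.le h.le) hθ htr hrT
  refine liqTime_eq_of_first_zero (by linarith) h2.le ?_ fun r htr hr => ne_of_gt ?_
  · rw [hraw (by linarith) h2.le, min_eq_right (by linarith), max_eq_left (by linarith)]
    linarith
  · rw [hraw htr (by linarith), sub_pos]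
    rcases le_total (r - t) θ with h' | h'
    · rw [min_eq_left h', max_eq_right (by linarith)]
      nlinarith
    · rw [min_eq_right h', max_eq_left (by linarith)]
      nlinarith

end LiquidationTimes

/-! ### The supplementary function and the adjoint process of the example -/

section Example

variable {T t q cplus cbar θ : ℝ}

lemma exControl_eq_const (cplus T t q : ℝ) :
    exControl cplus T t q = fun _ => exControl cplus T t q t := rfl

lemma exControl_nonneg (hc : 0 ≤ cplus) (htT : t < T) (hq : 0 < q) :
    0 ≤ exControl cplus T t q t := by
  unfold exControl
  split_ifs
  · exact div_nonneg hq.le (sub_nonneg.2 htT.le)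
  · exact hc

lemma exControl_mul_le (htT : t < T) : exControl cplus T t q t * (T - t) ≤ q := by
  unfold exControl
  split_ifs with h
  · rw [div_mul_cancel₀ _ (sub_pos.2 htT).ne']
  · exact (not_le.1 h).le

lemma liqTime_exControl (hc : 0 ≤ cplus) (htT : t < T) (hq : 0 < q) :
    liqTime T t q (exControl cplus T t q) = T := by
  rw [exControl_eq_const]
  exact liqTime_const hq (exControl_nonneg hc htT hq) (exControl_mul_le htT)

lemma exFbar_of_le {x : ℝ} (h : cbar ≤ exControl cplus T t q t) :
    exFbar cplus T t cbar x q = 0 := by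
  unfold exFbar
  split_ifs with h1 h2
  · rw [le_antisymm h h2]; simp
  · simp
  · rfl

/-- When the inventory is too large to be sold in time, the control is already `c⁺`, and no
admissible rate exceeds it. -/
lemma exFbar_of_lt {x : ℝ} (hcbar : cbar ≤ cplus) (h : exControl cplus T t q t < cbar) :
    q ≤ cplus * (T - t) ∧
      exFbar cplus T t cbar x q = (cbar - exControl cplus T t q t) * x := by
  have hq : q ≤ cplus * (T - t) := by
    by_contra hq
    rw [exControl, if_neg hq] at h
    exact absurd hcbar (not_le.2 h)
  refine ⟨hq, ?_⟩
  rw [exFbar, if_pos hq, if_pos h.le, mul_one]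

lemma inventory_exControl {t₀ q₀ : ℝ} (hc : 0 ≤ cplus) (hq : 0 < q₀) (ht₀ : t₀ ≤ t) (htT : t < T) :
    inventory T t₀ q₀ (exControl cplus T t₀ q₀) t =
      q₀ - exControl cplus T t₀ q₀ t₀ * (t - t₀) := by
  rw [inventory, liqTime_exControl hc (ht₀.trans_lt htT) hq, if_pos htT.le, exControl_eq_const,
    rawInventory_const]

/-- Along the optimal trajectory, the control started afresh is the original one. -/
lemma exControl_inventory {t₀ q₀ : ℝ} (hc : 0 ≤ cplus) (hq : 0 < q₀) (ht₀ : t₀ ≤ t)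
    (htT : t < T) :
    0 < inventory T t₀ q₀ (exControl cplus T t₀ q₀) t ∧
    exControl cplus T t (inventory T t₀ q₀ (exControl cplus T t₀ q₀) t) t =
      exControl cplus T t₀ q₀ t₀ := by
  rw [inventory_exControl hc hq ht₀ htT]
  have h0 := sub_pos.2 (ht₀.trans_lt htT)
  have h1 := sub_pos.2 htT
  by_cases h : q₀ ≤ cplus * (T - t₀)
  · have hk : exControl cplus T t₀ q₀ t₀ = q₀ / (T - t₀) := by rw [exControl, if_pos h]
    -- Inventory and remaining time shrink in proportion, so the ratio, and with it the case of the
    -- definition, persists.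
    have hQ : q₀ - q₀ / (T - t₀) * (t - t₀) = q₀ / (T - t₀) * (T - t) := by
      field_simp
      ring
    rw [hk, hQ]
    refine ⟨mul_pos (div_pos hq h0) h1, ?_⟩
    rw [exControl, if_pos (mul_le_mul_of_nonneg_right ((div_le_iff₀ h0).2 h) h1.le),
      mul_div_cancel_right₀ _ h1.ne']
  · have hk : exControl cplus T t₀ q₀ t₀ = cplus := by rw [exControl, if_neg h]
    rw [hk]
    push Not at h
    have hQ : cplus * (T - t) < q₀ - cplus * (t - t₀) := by linarith
    exact ⟨(mul_nonneg hc h1.le).trans_lt hQ, by rw [exControl, if_neg (not_le.2 hQ)]⟩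

variable {Ω : Type*} {mΩ : MeasurableSpace Ω} {P : Measure Ω} {W : ℝ≥0 → Ω → ℝ}
  {hWm : ∀ s, Measurable (W s)} {X : ℝ → Ω → ℝ} {x : ℝ}

/-- Both liquidation times are `T`, so the window of integration is empty, whatever the price
process. -/
lemma hasFbar_zero_of_le (hc : 0 ≤ cplus) (htT : t < T) (hq : 0 < q)
    (h : cbar ≤ exControl cplus T t q t) :
    HasFbar P exRunning T t q (exControl cplus T t q) cbar X 0 := by
  have hτ := liqTime_exControl hc htT hq
  have hvar : ∀ᶠ θ in 𝓝[>] (0 : ℝ),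
      liqTimeVar T t q (exControl cplus T t q) cbar θ = T := by
    filter_upwards [self_mem_nhdsWithin] with θ hθ
    rw [exControl_eq_const]
    exact liqTimeVar_of_le hq (exControl_nonneg hc htT hq) (exControl_mul_le htT) h hθ
  have hzero : ∀ᶠ θ in 𝓝[>] (0 : ℝ),
      runningDiff exRunning T t q (exControl cplus T t q) cbar X θ = 0 := by
    filter_upwards [hvar] with θ hθ
    ext ω
    simp [runningDiff, hθ, hτ]
  refine ⟨?_, ?_⟩
  · filter_upwards [hvar, hzero] with θ hθ h0
    rw [h0]
    exact ⟨ae_of_all _ fun ω => by rw [hθ, hτ, min_self, max_self],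
      integrable_zero _ _ _⟩
  · refine tendsto_const_nhds.congr' ?_
    filter_upwards [hzero] with θ h0
    simp [h0]

/-- The variation has already stopped and counts as zero. The left inequality is strict because a
control is still active at its own liquidation time. -/
lemma maxControl_between {c : ℝ → ℝ} {r : ℝ} (h1 : liqTimeVar T t q c cbar θ < r)
    (h2 : r ≤ liqTime T t q c) (hcr : 0 ≤ c r) : maxControl T t q c cbar θ r = c r := by
  unfold liqTimeVar at h1
  rw [maxControl, stoppedControl, stoppedControl, if_pos h2, if_neg (not_le.2 h1),
    max_eq_left hcr]

lemma hasGbar_exTerminal (c : ℝ → ℝ) : HasGbar P exTerminal T t q c cbar X 0 := by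
  have h : ∀ θ, terminalDiff exTerminal T t q c cbar X θ = fun _ => 0 := fun θ => by
    ext ω
    simp [terminalDiff, exTerminal]
  simp only [HasGbar, h]
  simp

lemma terminalMarginal_exTerminal (c : ℝ → ℝ) :
    terminalMarginal exTerminal T t q c cbar X = fun _ => 0 := by
  ext ω
  simp [terminalMarginal, exTerminal]

variable [IsProbabilityMeasure P]

/-- Rate `k`, mean price `x` and a window of length `(c̄ - k) θ / k` give a quotient that does not
depend on small `θ`. -/
lemma hasFbar_of_lt (hW : IsPreBrownianReal W P) (ht : 0 ≤ t) (htT : t < T) (hc : 0 ≤ cplus)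
    (hq : 0 < q) (hqc : q ≤ cplus * (T - t)) (h : exControl cplus T t q t < cbar)
    (hX : IsSDESolution P W hWm exDrift exVol t T x X) :
    HasFbar P exRunning T t q (exControl cplus T t q) cbar X
      ((cbar - exControl cplus T t q t) * x) := by
  have hτ := liqTime_exControl hc htT hq
  have hkq : exControl cplus T t q t * (T - t) = q := by
    rw [exControl, if_pos hqc, div_mul_cancel₀ _ (sub_pos.2 htT).ne']
  have hk : 0 < exControl cplus T t q t := by
    rw [exControl, if_pos hqc]
    exact div_pos hq (sub_pos.2 htT)
  set k := exControl cplus T t q t with hk_def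
  have hcbar : 0 < cbar := hk.trans h
  have hev : ∀ᶠ θ in 𝓝[>] (0 : ℝ), 0 < θ ∧ t ≤ T - (cbar - k) * θ / k ∧
      T - (cbar - k) * θ / k < T ∧
      liqTimeVar T t q (exControl cplus T t q) cbar θ = T - (cbar - k) * θ / k := by
    -- The threshold `q / c̄` is exactly the condition `c̄ θ < q` of `liqTimeVar_of_lt`.
    filter_upwards [Ioo_mem_nhdsGT (div_pos hq hcbar)] with θ hθ
    obtain ⟨h1, h2, h3⟩ := liqTimeVar_of_lt htT hk hkq h hθ.1
      (by rw [mul_comm]; exact (lt_div_iff₀ hcbar).1 hθ.2)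
    exact ⟨hθ.1, by linarith [hθ.1], h2, h3⟩
  have hcongr : ∀ θ, liqTimeVar T t q (exControl cplus T t q) cbar θ = T - (cbar - k) * θ / k →
      ∀ ω, ∀ r ∈ Ioc (T - (cbar - k) * θ / k) T,
        exRunning r (maxControl T t q (exControl cplus T t q) cbar θ r) (X r ω)
          (maxInventory T t q (exControl cplus T t q) cbar θ r) = k * X r ω := by
    intro θ hθ ω r hr
    rw [exRunning, maxControl_between (hθ.trans_lt hr.1) (hr.2.trans_eq hτ.symm) hk.le]
    rfl
  have hdiff : ∀ᶠ θ in 𝓝[>] (0 : ℝ),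
      runningDiff exRunning T t q (exControl cplus T t q) cbar X θ =
        fun ω => k / θ * ∫ r in (T - (cbar - k) * θ / k)..T, X r ω := by
    filter_upwards [hev] with θ ⟨h0, h1, h2, h3⟩
    ext ω
    rw [runningDiff, h3, hτ, min_eq_right h2.le, max_eq_left h2.le,
      Real.sign_of_pos (sub_pos.2 h2), intervalIntegral.integral_of_le h2.le,
      setIntegral_congr_fun measurableSet_Ioc (hcongr θ h3 ω), integral_const_mul,
      intervalIntegral.integral_of_le h2.le]
    ring
  refine ⟨?_, ?_⟩
  · filter_upwards [hev, hdiff] with θ ⟨h0, h1, h2, h3⟩ hd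
    obtain ⟨i1, i2, -⟩ := hX.integral_integral_eq hW ht h1 h2.le
    rw [hd, h3, hτ, min_eq_right h2.le, max_eq_left h2.le]
    refine ⟨?_, i2.const_mul _⟩
    filter_upwards [i1] with ω hω
    rw [intervalIntegrable_iff_integrableOn_Ioc_of_le h2.le] at hω ⊢
    rw [integrableOn_congr_fun (hcongr θ h3 ω) measurableSet_Ioc]
    exact hω.const_mul k
  · refine tendsto_const_nhds.congr' ?_
    filter_upwards [hev, hdiff] with θ ⟨h0, h1, h2, h3⟩ hd
    obtain ⟨-, -, i3⟩ := hX.integral_integral_eq hW ht h1 h2.le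
    rw [hd, integral_const_mul, i3]
    field_simp
    ring

lemma hasFbar_exFbar (hW : IsPreBrownianReal W P) (hc : 0 ≤ cplus) (ht : t ∈ Ico 0 T)
    (hcbar : cbar ≤ cplus) (hq : 0 < q) (hX : IsSDESolution P W hWm exDrift exVol t T x X) :
    HasFbar P exRunning T t q (exControl cplus T t q) cbar X (exFbar cplus T t cbar x q) := by
  rcases le_or_gt cbar (exControl cplus T t q t) with h | h
  · rw [exFbar_of_le h]
    exact hasFbar_zero_of_le hc ht.2 hq h
  · obtain ⟨hqc, he⟩ := exFbar_of_lt (x := x) hcbar h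
    rw [he]
    exact hasFbar_of_lt hW ht.1 ht.2 hc hq hqc h hX

lemma hasSupplementaryTerm_exFbar (hW : IsPreBrownianReal W P) (hc : 0 ≤ cplus)
    (ht : t ∈ Ico 0 T) (hcbar : cbar ≤ cplus) (hq : 0 < q)
    (hX : IsSDESolution P W hWm exDrift exVol t T x X) :
    HasSupplementaryTerm P exRunning exTerminal T t q (exControl cplus T t q) cbar X
      (-exFbar cplus T t cbar x q) := by
  refine ⟨0, _, hasGbar_exTerminal _, hasFbar_exFbar hW hc ht hcbar hq hX, ?_, ?_⟩
  · rw [terminalMarginal_exTerminal]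
    exact integrable_const 0
  · simp [terminalMarginal_exTerminal]

/-- Uniqueness of limits determines the value, so the Hamiltonian condition can be checked for an
arbitrary supplementary function. -/
lemma HasSupplementaryTerm.eq_neg_exFbar {G : ℝ} (hW : IsPreBrownianReal W P) (hc : 0 ≤ cplus)
    (ht : t ∈ Ico 0 T) (hcbar : cbar ≤ cplus) (hq : 0 < q)
    (hX : IsSDESolution P W hWm exDrift exVol t T x X)
    (h : HasSupplementaryTerm P exRunning exTerminal T t q (exControl cplus T t q) cbar X G) :
    G = -exFbar cplus T t cbar x q := by
  obtain ⟨gbar, fbar, hg, hf, -, rfl⟩ := h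
  rw [tendsto_nhds_unique hg.2 (hasGbar_exTerminal _).2,
    tendsto_nhds_unique hf.2 (hasFbar_exFbar hW hc ht hcbar hq hX).2]
  simp [terminalMarginal_exTerminal]

/-- Neither payoff depends on the inventory, so driver and terminal value vanish and `-Y t` is
itself an Itô integral over the remaining interval. -/
lemma IsBSDESolution.ae_eq_zero {Y Z : ℝ → Ω → ℝ} {t₀ : ℝ} {c : ℝ → ℝ}
    (hW : IsPreBrownianReal W P) (ht₀ : 0 ≤ t₀)
    (h : IsBSDESolution P W hWm exRunning exTerminal T t₀ q c X Y Z)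
    (ht : t ∈ Icc t₀ (liqTime T t₀ q c)) : Y t =ᵐ[P] 0 := by
  have h1 := h.equation t ht
  simp only [exRunning, exTerminal, deriv_const, intervalIntegral.integral_zero, add_zero,
    zero_sub] at h1
  exact h1.ae_eq_zero_of_neg_adapted hW (ht₀.trans ht.1) (h.adapted t ht)

end Example

end Liquidation

/-! ### The main result -/

theorem proposition2 {Ω : Type*} {mΩ : MeasurableSpace Ω} (P : Measure Ω) [IsProbabilityMeasure P]
    (W : ℝ≥0 → Ω → ℝ) (hWm : ∀ s, Measurable (W s)) (hW : IsBrownianReal W P)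
    (T cplus : ℝ) (hT : 0 < T) (hcplus : 0 ≤ cplus) :
    -- the closed form of `f̄`
    (∀ t ∈ Ico 0 T, ∀ cbar ∈ Icc 0 cplus, ∀ x q : ℝ, 0 < x → 0 < q → ∀ X : ℝ → Ω → ℝ,
      Liquidation.IsSDESolution P W hWm Liquidation.exDrift Liquidation.exVol t T x X →
        Liquidation.HasFbar P Liquidation.exRunning T t q (Liquidation.exControl cplus T t q)
          cbar X (Liquidation.exFbar cplus T t cbar x q)) ∧
    -- the supplementary function `𝒢` exists
    (∃ 𝒢 : ℝ → ℝ → ℝ → ℝ → ℝ, Liquidation.IsExSupplementary P W hWm cplus T 𝒢) ∧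
    -- the Hamiltonian condition along the optimal trajectory from any `(t₀, x₀, q₀)`
    (∀ 𝒢 : ℝ → ℝ → ℝ → ℝ → ℝ, Liquidation.IsExSupplementary P W hWm cplus T 𝒢 →
      ∀ t₀ ∈ Ico 0 T, ∀ x₀ q₀ : ℝ, 0 < x₀ → 0 < q₀ → ∀ X Y Z : ℝ → Ω → ℝ,
        Liquidation.IsSDESolution P W hWm Liquidation.exDrift Liquidation.exVol t₀ T x₀ X →
        Liquidation.IsBSDESolution P W hWm Liquidation.exRunning Liquidation.exTerminal T t₀ q₀
          (Liquidation.exControl cplus T t₀ q₀) X Y Z →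
        ∀ t ∈ Ico t₀ (Liquidation.liqTime T t₀ q₀ (Liquidation.exControl cplus T t₀ q₀)),
        ∀ cbar ∈ Icc 0 cplus, ∀ᵐ ω ∂P,
          Liquidation.hamiltonian Liquidation.exRunning t cbar (X t ω)
              (Liquidation.inventory T t₀ q₀ (Liquidation.exControl cplus T t₀ q₀) t) (Y t ω)
            - Liquidation.hamiltonian Liquidation.exRunning t
              (Liquidation.exControl cplus T t₀ q₀ t) (X t ω)
              (Liquidation.inventory T t₀ q₀ (Liquidation.exControl cplus T t₀ q₀) t) (Y t ω)
            + 𝒢 t cbar (X t ω)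
              (Liquidation.inventory T t₀ q₀ (Liquidation.exControl cplus T t₀ q₀) t) ≤ 0) := by
  have hW' := hW.toIsPreBrownianReal
  refine ⟨?_, ?_, ?_⟩
  · intro t ht cbar hcbar x q _ hq X hX
    exact Liquidation.hasFbar_exFbar hW' hcplus ht hcbar.2 hq hX
  · refine ⟨fun t cbar x q => -Liquidation.exFbar cplus T t cbar x q, ?_⟩
    intro t ht cbar hcbar x q _ hq X hX
    exact Liquidation.hasSupplementaryTerm_exFbar hW' hcplus ht hcbar.2 hq hX
  · intro 𝒢 h𝒢 t₀ ht₀ x₀ q₀ hx₀ hq₀ X Y Z hX hYZ t ht cbar hcbar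
    have hY := hYZ.ae_eq_zero hW' ht₀.1 ⟨ht.1, ht.2.le⟩
    rw [Liquidation.liqTime_exControl hcplus ht₀.2 hq₀] at ht
    have ht' : t ∈ Ico 0 T := ⟨ht₀.1.trans ht.1, ht.2⟩
    obtain ⟨hQ, hc⟩ := Liquidation.exControl_inventory hcplus hq₀ ht.1 ht.2
    filter_upwards [hY, hX.ae_pos hW ht₀.1 hx₀ ⟨ht.1, ht.2.le⟩] with ω hYω hXω
    -- With `ω` fixed, `X t ω` is a positive number. The value of `𝒢` there is known only through a
    -- solution started from it at time `t`, and the exponential martingale provides one.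
    have hsol := Liquidation.isSDESolution_expMartingale hWm hW ht'.1 hXω T
    rw [(h𝒢 t ht' cbar hcbar _ _ hXω hQ _ hsol).eq_neg_exFbar hW' hcplus ht' hcbar.2 hQ hsol]
    simp only [Liquidation.hamiltonian, Liquidation.exRunning, hYω, Pi.zero_apply, mul_zero,
      zero_add]
    change cbar * X t ω - Liquidation.exControl cplus T t₀ q₀ t₀ * X t ω + _ ≤ 0
    -- The rate is now that of the problem restarted at `(t, Q_t)`, the one that occurs in `f̄`.
    -- Below it `f̄` vanishes and the linear term is nonpositive; above it the two cancel.
    rw [← hc]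
    rcases le_or_gt cbar (Liquidation.exControl cplus T t (Liquidation.inventory T t₀ q₀
      (Liquidation.exControl cplus T t₀ q₀) t) t) with h | h
    · rw [Liquidation.exFbar_of_le h]
      nlinarith
    · rw [(Liquidation.exFbar_of_lt hcbar.2 h).2]
      linarith
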